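/- Let $\mathcal M^*$ be the set of positive Borel measures on $\mathbb R$ with infinite support and finite moments of every order. A measure $\mu\in\mathcal M^*$ is called determinate if it is the only measure in $\mathcal M^*$ with its moments, and indeterminate otherwise; $\mathcal M^*_d$ and $\mathcal M^*_i$ denote the sets of determinate and of indeterminate measures in $\mathcal M^*$. For $\mu\in\mathcal M^*$ let $(p_n)_{n\ge 0}$ be the orthonormal polynomials of $\mu$ ($p_n$ of degree $n$ with positive leading coefficient), let $q_n(z)=\int\frac{p_n(z)-p_n(x)}{z-x}\,d\mu(x)$ (with the value $p_n'(x)$ of the integrand at $x=z$), and for $\mu\in\mathcal M_i^*$ put $$A(z)=z\sum_{k\ge0}q_k(0)q_k(z),\quad B(z)=-1+z\sum_{k\ge0}q_k(0)p_k(z),\quad C(z)=1+z\sum_{k\ge0}p_k(0)q_k(z),\quad D(z)=z\sum_{k\ge0}p_k(0)p_k(z).$$ A measure $\mu\in\mathcal M^*_i$ is called N-extremal if there is $t\in\mathbb R\cup\{\infty\}$ such that $$\int\frac{d\mu(x)}{x-z}=-\frac{A(z)+tC(z)}{B(z)+tD(z)}\qquad(z\in\mathbb C\setminus\mathbb R),$$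 where the right-hand side is $-C(z)/D(z)$ for $t=\infty$. Let $\mathcal M^*_{i,0}$ be the set of indeterminate N-extremal measures. For $\mu\in\mathcal M^*_{i,0}$ put $$a(\mu)=\sup\{\alpha\in[0,1] : (1+x^2)^{-\alpha}d\mu(x)\in\mathcal M^*_i\},$$ and let $$\mathcal A=\{\mu\in\mathcal M^*_{i,0} : (1+x^2)^{-a(\mu)}d\mu(x)\in\mathcal M^*_i\},\qquad \mathcal B=\{\mu\in\mathcal M^*_{i,0} : (1+x^2)^{-a(\mu)}d\mu(x)\in\mathcal M^*_d\}.$$ Then: (i) $\mathcal A\neq\emptyset$ if and only if there exists $\nu\in\mathcal M^*_{i,0}$ such that $(1+x^2)^{-\delta}d\nu(x)\in\mathcal M^*_d$ for every $\delta>0$. (ii) $\mathcal B\neq\emptyset$ if and only if there exists $\nu\in\mathcal M^*_d$ such that $(1+x^2)^{\delta}d\nu(x)\in\mathcal M^*_i$ for every $\delta>0$. -/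

import Mathlib

open MeasureTheory Polynomial

noncomputable section

namespace MomentProblem

/-- The class `M*`: positive Borel measures on `ℝ` with infinite support and finite moments of
every order (in particular they are finite measures). -/
def MStar : Set (Measure ℝ) :=
  {μ | μ.support.Infinite ∧ ∀ n : ℕ, Integrable (fun x : ℝ => x ^ n) μ}

/-- The moments `s_n = ∫ x^n dμ(x)`. -/
def moment (μ : Measure ℝ) (n : ℕ) : ℝ := ∫ x, x ^ n ∂μ

/-- The solutions in `M*` of the moment problem of `μ`. -/
def solutions (μ : Measure ℝ) : Set (Measure ℝ) :=
  {ν | ν ∈ MStar ∧ ∀ n : ℕ, moment ν n = moment μ n}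

/-- Determinate measures of `M*`. -/
def Md : Set (Measure ℝ) := {μ | μ ∈ MStar ∧ ∀ ν ∈ solutions μ, ν = μ}

/-- Indeterminate measures of `M*`. -/
def Mi : Set (Measure ℝ) := {μ | μ ∈ MStar ∧ ∃ ν ∈ solutions μ, ν ≠ μ}

/-- `p` is the sequence of orthonormal polynomials of `μ`: `p n` has degree `n` and positive
leading coefficient, and `∫ p_n p_m dμ = δ_{n,m}`. For `μ` in `M*` there is exactly one. -/
structure IsOrthonormalPolys (μ : Measure ℝ) (p : ℕ → ℝ[X]) : Prop where
  natDegree_eq : ∀ n, (p n).natDegree = n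
  leadingCoeff_pos : ∀ n, 0 < (p n).leadingCoeff
  integral_mul : ∀ n m, ∫ x, (p n).eval x * (p m).eval x ∂μ = if n = m then 1 else 0

/-- The value `p(z)` of a real polynomial at a complex point. -/
def cval (p : ℝ[X]) (z : ℂ) : ℂ := aeval z p

/-- Polynomials of the second kind, `q(z) = ∫ (p(z) - p(x)) / (z - x) dμ(x)`. `dslope` is the
difference quotient, with its continuous value `p'(x)` at `z = x`. -/
def secondKind (μ : Measure ℝ) (p : ℝ[X]) (z : ℂ) : ℂ :=
  ∫ x : ℝ, dslope (cval p) (x : ℂ) z ∂μ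

/-- `A(z) = z ∑ q_k(0) q_k(z)`. -/
def nevA (μ : Measure ℝ) (p : ℕ → ℝ[X]) (z : ℂ) : ℂ :=
  z * ∑' k, secondKind μ (p k) 0 * secondKind μ (p k) z

/-- `B(z) = -1 + z ∑ q_k(0) p_k(z)`. -/
def nevB (μ : Measure ℝ) (p : ℕ → ℝ[X]) (z : ℂ) : ℂ :=
  -1 + z * ∑' k, secondKind μ (p k) 0 * cval (p k) z

/-- `C(z) = 1 + z ∑ p_k(0) q_k(z)`. -/
def nevC (μ : Measure ℝ) (p : ℕ → ℝ[X]) (z : ℂ) : ℂ :=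
  1 + z * ∑' k, cval (p k) 0 * secondKind μ (p k) z

/-- `D(z) = z ∑ p_k(0) p_k(z)`. -/
def nevD (p : ℕ → ℝ[X]) (z : ℂ) : ℂ :=
  z * ∑' k, cval (p k) 0 * cval (p k) z

/-- The Nevanlinna fraction `-(A + t C) / (B + t D)` for `t ∈ ℝ ∪ {∞}`;
for `t = ∞` it is `-C / D`. -/
def nevFraction (μ : Measure ℝ) (p : ℕ → ℝ[X]) : OnePoint ℝ → ℂ → ℂ
  | some t, z => -(nevA μ p z + (t : ℂ) * nevC μ p z) / (nevB μ p z + (t : ℂ) * nevD p z)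
  | none, z => -(nevC μ p z) / nevD p z

/-- The Stieltjes transform `∫ dμ(x) / (x - z)`. -/
def stieltjesTransform (μ : Measure ℝ) (z : ℂ) : ℂ := ∫ x : ℝ, 1 / ((x : ℂ) - z) ∂μ

/-- `M*_{i,0}`: the indeterminate measures that are N-extremal, that is, whose Nevanlinna parameter
is a constant in `ℝ ∪ {∞}`. No normalization of the total mass is needed: if `μ` is multiplied by
`c > 0`, then `A, B, C, D` become `c A, B, C, D / c` and the parameter `t` becomes `c t`. -/
def Mi0 : Set (Measure ℝ) :=
  {μ | μ ∈ Mi ∧ ∃ p : ℕ → ℝ[X], IsOrthonormalPolys μ p ∧ ∃ t : OnePoint ℝ,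
    ∀ z : ℂ, z.im ≠ 0 → stieltjesTransform μ z = nevFraction μ p t z}

/-- The measure `(1 + x²)^α dμ(x)`. -/
def weighted (α : ℝ) (μ : Measure ℝ) : Measure ℝ :=
  μ.withDensity fun x => ENNReal.ofReal ((1 + x ^ 2) ^ α)

/-- `A(α)`: the `μ ∈ M*_i` such that `(1 + x²)^{-α} dμ` is indeterminate. -/
def setAα (α : ℝ) : Set (Measure ℝ) := {μ | μ ∈ Mi ∧ weighted (-α) μ ∈ Mi}

/-- `a(μ) = sup {α ∈ [0,1] | μ ∈ A(α)}`; for `μ ∈ M*_{i,0}` this set contains `0`. -/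
def aIndex (μ : Measure ℝ) : ℝ := sSup {α : ℝ | α ∈ Set.Icc (0 : ℝ) 1 ∧ μ ∈ setAα α}

/-- `A`: the `μ ∈ M*_{i,0}` such that `(1 + x²)^{-a(μ)} dμ` is indeterminate. -/
def setA : Set (Measure ℝ) := {μ | μ ∈ Mi0 ∧ weighted (-aIndex μ) μ ∈ Mi}

/-- `B`: the `μ ∈ M*_{i,0}` such that `(1 + x²)^{-a(μ)} dμ` is determinate. -/
def setB : Set (Measure ℝ) := {μ | μ ∈ Mi0 ∧ weighted (-aIndex μ) μ ∈ Md}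

end MomentProblem

end

/-!
For a measure `μ` with finite moments consider two conditions: the evaluation `P ↦ P(i)` of
polynomials is bounded in the norm of `L²(μ)` (`BoundedEval`), and `1 / (x - i)` is an `L²(μ)`-limit
of polynomials (`ResolventApprox`). The first is inherited by larger measures, the second by smaller
ones, and since multiplication by `x - i` is an isometry from `L²((1 + x²) dμ)` to `L²(μ)`, the second
holds for `(1 + x²) dμ` if and only if the first fails for `μ`
(`resolventApprox_weighted_one_iff`). The theorem follows from two facts.

* `μ` is determinate if and only if evaluation at `i` is unbounded (`mem_Md_iff`).
  If it is unbounded, then `1 / (x - i)` is a limit of polynomials in `L²(μ + σ)` for every solution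
  `σ` of the moment problem; since `P / (x - i)` is a polynomial up to a multiple of `1 / (x - i)`,
  the limits of polynomials are stable under the star algebra generated by `1 / (x - i)`, and `μ`, `σ`
  agree on this algebra. Conversely, for determinate `μ` the Hahn–Banach and
  Riesz–Markov–Kakutani theorems show that `x / (1 + x²)` lies between polynomials with arbitrarily
  close integrals. Writing the two differences as `|S|² / (1 + x²)` and `|T|² / (1 + x²)`, the
  polynomial `(T(i) S - S(i) T) / (x - i)` has small norm, but its value at `-i` is at least `1` in
  modulus.

* An indeterminate measure is N-extremal if and only if `ResolventApprox` holds
  (`resolventApprox_of_mem_Mi0`, `mem_Mi0_of_resolventApprox`).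
  For `κ = ∑ p_k(0) p_k` and `l = ∑ q_k(0) p_k` in `L²(μ)`, and with the Stieltjes transform `F` of `μ`,
  `b (A + F B) + a (C + F D)` is the Stieltjes transform of `(x ξ - b) dμ`, where `ξ = b l + a κ`. So
  `μ` is N-extremal exactly if `x ξ = b` for some real `(a, b) ≠ 0` (and then the denominator does not
  vanish). The functions `x ξ - b` annihilate the polynomials, and when the polynomials are dense the
  annihilator is one-dimensional, which provides the relation. Given the relation, approximating
  `(x - i) ξ = b - i ξ` by polynomials approximates `1 / (x - i)`.

So for N-extremal `μ` the measure `(1 + x²)^α dμ` is indeterminate for `α > -a(μ)` and determinate for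
`α < -a(μ)`. In both parts `μ` gives `ν = (1 + x²)^{-a(μ)} dμ`. Conversely, `ν` itself has index `0` in
(i), and `(1 + x²) dν` is N-extremal with index `1` in (ii).
-/


noncomputable section

namespace MomentProblem

open scoped BoundedContinuousFunction ComplexConjugate CompactlySupported
open Complex (I)

/-! ### Finite moments and the `L²`-norm -/

/-- All moments of `μ` are finite. -/
def HasMoments (μ : Measure ℝ) : Prop := ∀ n : ℕ, Integrable (fun x : ℝ => x ^ n) μ

lemma HasMoments.isFiniteMeasure {μ : Measure ℝ} (h : HasMoments μ) : IsFiniteMeasure μ := by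
  have := h 0
  simp only [pow_zero] at this
  exact (integrable_const_iff_isFiniteMeasure one_ne_zero).1 this

lemma HasMoments.add {μ σ : Measure ℝ} (h : HasMoments μ) (h' : HasMoments σ) :
    HasMoments (μ + σ) := fun n => (h n).add_measure (h' n)

lemma HasMoments.integrable_eval {μ : Measure ℝ} (h : HasMoments μ) (P : ℝ[X]) :
    Integrable (fun x => P.eval x) μ := by
  simp only [eval_eq_sum_range]
  exact integrable_finsetSum _ fun i _ => (h i).const_mul _

lemma HasMoments.integrable_ceval {μ : Measure ℝ} (h : HasMoments μ) (P : ℂ[X]) :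
    Integrable (fun x : ℝ => P.eval (x : ℂ)) μ := by
  simp only [eval_eq_sum_range]
  refine integrable_finsetSum _ fun i _ => Integrable.const_mul ?_ _
  simpa using (h i).ofReal (𝕜 := ℂ)

lemma measurable_ceval (P : ℂ[X]) : Measurable (fun x : ℝ => P.eval (x : ℂ)) :=
  (P.continuous.comp Complex.continuous_ofReal).measurable

/-- The polynomial with conjugated coefficients, which is the complex conjugate on the real
line. -/
def conjPoly (P : ℂ[X]) : ℂ[X] := P.map (starRingEnd ℂ)

lemma eval_conjPoly (P : ℂ[X]) (z : ℂ) : (conjPoly P).eval z = conj (P.eval (conj z)) := by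
  rw [conjPoly, eval_map, ← Polynomial.eval₂_hom, Complex.conj_conj]

lemma eval_conjPoly_ofReal (P : ℂ[X]) (x : ℝ) :
    (conjPoly P).eval (x : ℂ) = conj (P.eval (x : ℂ)) := by
  rw [eval_conjPoly, Complex.conj_ofReal]

lemma exists_real_polys (P : ℂ[X]) : ∃ P₁ P₂ : ℝ[X],
    P = P₁.map Complex.ofRealHom + C I * P₂.map Complex.ofRealHom := by
  refine ⟨∑ n ∈ P.support, monomial n (P.coeff n).re, ∑ n ∈ P.support, monomial n (P.coeff n).im, ?_⟩
  ext n
  simp only [Polynomial.map_sum, map_monomial, coeff_add, finsetSum_coeff, coeff_monomial, coeff_C_mul]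
  simp only [Finset.sum_ite_eq', mem_support_iff]
  by_cases h : P.coeff n = 0
  · simp [h]
  · simp [h, mul_comm I, Complex.re_add_im]

lemma eval_map_ofReal (P : ℝ[X]) (x : ℝ) :
    (P.map Complex.ofRealHom).eval (x : ℂ) = (P.eval x : ℝ) := by
  rw [eval_map]; exact Polynomial.eval₂_hom Complex.ofRealHom x

lemma exists_normSq_poly (P : ℂ[X]) : ∃ Q : ℝ[X], ∀ x : ℝ, ‖P.eval (x : ℂ)‖ ^ 2 = Q.eval x := by
  obtain ⟨P₁, P₂, rfl⟩ := exists_real_polys P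
  refine ⟨P₁ * P₁ + P₂ * P₂, fun x => ?_⟩
  rw [← Complex.normSq_eq_norm_sq]
  simp [eval_map_ofReal, Complex.normSq_apply]

lemma HasMoments.memLp {μ : Measure ℝ} (h : HasMoments μ) (P : ℂ[X]) :
    MemLp (fun x : ℝ => P.eval (x : ℂ)) 2 μ := by
  rw [memLp_two_iff_integrable_sq_norm (measurable_ceval P).aestronglyMeasurable]
  obtain ⟨Q, hQ⟩ := exists_normSq_poly P
  simp only [hQ]
  exact h.integrable_eval Q

/-- The squared `L²` norm of a complex function. -/
def l2sq (μ : Measure ℝ) (f : ℝ → ℂ) : ℝ := ∫ x, ‖f x‖ ^ 2 ∂μ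

lemma l2sq_nonneg (μ : Measure ℝ) (f : ℝ → ℂ) : 0 ≤ l2sq μ f :=
  integral_nonneg fun _ => by positivity

lemma norm_integral_mul_sq_le {μ : Measure ℝ} {f g : ℝ → ℂ} (hf : MemLp f 2 μ) (hg : MemLp g 2 μ) :
    ‖∫ x, f x * g x ∂μ‖ ^ 2 ≤ l2sq μ f * l2sq μ g := by
  have h2 : ENNReal.ofReal (2 : ℝ) = 2 := by norm_num
  have := integral_mul_norm_le_Lp_mul_Lq (μ := μ) (f := f) (g := g) (p := 2) (q := 2)
    Real.HolderConjugate.two_two (by rwa [h2]) (by rwa [h2])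
  have h1 : ‖∫ x, f x * g x ∂μ‖ ≤ √(l2sq μ f) * √(l2sq μ g) := by
    refine (norm_integral_le_integral_norm _).trans ?_
    simpa [Real.sqrt_eq_rpow, l2sq] using this
  calc _ ≤ (√(l2sq μ f) * √(l2sq μ g)) ^ 2 := by gcongr
    _ = _ := by rw [mul_pow, Real.sq_sqrt (l2sq_nonneg _ _), Real.sq_sqrt (l2sq_nonneg _ _)]

lemma l2sq_add_le {μ : Measure ℝ} {f g : ℝ → ℂ} (hf : MemLp f 2 μ) (hg : MemLp g 2 μ) :
    l2sq μ (fun x => f x + g x) ≤ 2 * l2sq μ f + 2 * l2sq μ g := by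
  have hf' := (memLp_two_iff_integrable_sq_norm hf.1).1 hf
  have hg' := (memLp_two_iff_integrable_sq_norm hg.1).1 hg
  rw [l2sq, l2sq, l2sq, ← integral_const_mul, ← integral_const_mul,
    ← integral_add (hf'.const_mul _) (hg'.const_mul _)]
  refine integral_mono ((memLp_two_iff_integrable_sq_norm (hf.add hg).1).1 (hf.add hg))
    ((hf'.const_mul _).add (hg'.const_mul _)) fun x => ?_
  have := norm_add_le (f x) (g x)
  have h0 := norm_nonneg (f x + g x)
  simp only
  nlinarith [sq_nonneg (‖f x‖ - ‖g x‖)]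

lemma l2sq_mono {μ : Measure ℝ} {f g : ℝ → ℂ} (hg : MemLp g 2 μ)
    (h : ∀ x, ‖f x‖ ≤ ‖g x‖) : l2sq μ f ≤ l2sq μ g :=
  integral_mono_of_nonneg (.of_forall fun _ => by positivity)
    ((memLp_two_iff_integrable_sq_norm hg.1).1 hg) (.of_forall fun x => by
      have := h x
      simp only; gcongr)

lemma l2sq_const_mul (μ : Measure ℝ) (c : ℂ) (f : ℝ → ℂ) :
    l2sq μ (fun x => c * f x) = ‖c‖ ^ 2 * l2sq μ f := by
  simp only [l2sq, norm_mul, mul_pow, integral_const_mul]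

/-! ### The algebra generated by the resolvents -/

lemma abs_im_le_norm_sub (z : ℂ) (x : ℝ) : |z.im| ≤ ‖(x : ℂ) - z‖ := by
  simpa using Complex.abs_im_le_norm ((x : ℂ) - z)

lemma ofReal_sub_ne_zero {z : ℂ} (hz : z.im ≠ 0) (x : ℝ) : (x : ℂ) - z ≠ 0 := by
  intro h
  have := abs_im_le_norm_sub z x
  rw [h, norm_zero] at this
  exact hz (abs_nonpos_iff.1 this)

lemma norm_resolvent_le {z : ℂ} (hz : z.im ≠ 0) (x : ℝ) : ‖1 / ((x : ℂ) - z)‖ ≤ 1 / |z.im| := by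
  rw [norm_div, norm_one]
  exact one_div_le_one_div_of_le (abs_pos.2 hz) (abs_im_le_norm_sub z x)

lemma continuous_resolvent {z : ℂ} (hz : z.im ≠ 0) : Continuous fun x : ℝ => 1 / ((x : ℂ) - z) :=
  continuous_const.div (by fun_prop) (ofReal_sub_ne_zero hz)

/-- The function `x ↦ 1 / (x - z)` for nonreal `z`, as a bounded continuous function. -/
def resolventBCF (z : ℂ) (hz : z.im ≠ 0) : ℝ →ᵇ ℂ :=
  BoundedContinuousFunction.ofNormedAddCommGroup _ (continuous_resolvent hz) _ (norm_resolvent_le hz)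

lemma resolventBCF_apply (z : ℂ) (hz : z.im ≠ 0) (x : ℝ) :
    resolventBCF z hz x = 1 / ((x : ℂ) - z) := rfl

/-- The star algebra generated by `1 / (x - i)`. -/
def resolventAlg : StarSubalgebra ℂ (ℝ →ᵇ ℂ) :=
  StarAlgebra.adjoin ℂ {resolventBCF I (by simp)}

lemma resolventAlg_induction {p : (ℝ →ᵇ ℂ) → Prop}
    (hp : ∀ z hz, z = I ∨ z = -I → p (resolventBCF z hz))
    (hc : ∀ c : ℂ, p (algebraMap ℂ _ c)) (ha : ∀ f g, p f → p g → p (f + g))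
    (hm : ∀ f g, p f → p g → p (f * g)) : ∀ r ∈ resolventAlg, p r := by
  intro r hr
  rw [resolventAlg, ← StarSubalgebra.mem_toSubalgebra, StarAlgebra.adjoin_toSubalgebra] at hr
  refine Algebra.adjoin_induction (p := fun r _ => p r) ?_ hc (fun f g _ _ => ha f g)
    (fun f g _ _ => hm f g) hr
  rintro x (hx | hx)
  · rw [Set.mem_singleton_iff.1 hx]
    exact hp _ _ (.inl rfl)
  · have : x = resolventBCF (-I) (by simp) := by
      rw [Set.mem_star, Set.mem_singleton_iff] at hx
      rw [← star_star x, hx]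
      ext y
      change conj (1 / ((y : ℂ) - I)) = 1 / ((y : ℂ) - -I)
      simp
    rw [this]
    exact hp _ _ (.inr rfl)

lemma resolventAlg_separatesPoints :
    (resolventAlg.map (BoundedContinuousFunction.toContinuousMapStarₐ ℂ)).SeparatesPoints := by
  intro x y hxy
  refine ⟨_, ⟨_, ⟨resolventBCF I (by simp), StarAlgebra.self_mem_adjoin_singleton _ _, rfl⟩, rfl⟩, ?_⟩
  change 1 / ((x : ℂ) - I) ≠ 1 / ((y : ℂ) - I)
  intro h
  rw [div_eq_div_iff (ofReal_sub_ne_zero (by simp) _) (ofReal_sub_ne_zero (by simp) _)] at h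
  apply hxy
  have := congrArg Complex.re h
  simpa using this.symm

lemma ext_of_resolventAlg {μ σ : Measure ℝ} [IsFiniteMeasure μ] [IsFiniteMeasure σ]
    (h : ∀ r ∈ resolventAlg, ∫ x, r x ∂μ = ∫ x, r x ∂σ) : μ = σ :=
  ext_of_forall_mem_subalgebra_integral_eq_of_polish resolventAlg_separatesPoints h

lemma integral_withDensity_ofReal {μ : Measure ℝ} {f : ℝ → ℝ} (hf : AEMeasurable f μ)
    (h0 : ∀ x, 0 ≤ f x) (g : ℝ → ℂ) :
    ∫ x, g x ∂(μ.withDensity fun x => ENNReal.ofReal (f x)) = ∫ x, (f x : ℂ) * g x ∂μ := by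
  rw [integral_withDensity_eq_integral_toReal_smul₀ hf.ennreal_ofReal (by simp)]
  refine integral_congr_ae (.of_forall fun x => ?_)
  simp [ENNReal.toReal_ofReal (h0 x)]

/-- The measures with densities the positive and negative parts of `g` agree. -/
lemma ae_eq_zero_of_resolventAlg_real {μ : Measure ℝ} {g : ℝ → ℝ}
    (hg : Integrable g μ) (h : ∀ r ∈ resolventAlg, ∫ x, (g x : ℂ) * r x ∂μ = 0) : g =ᵐ[μ] 0 := by
  have hp := hg.pos_part
  have hn := hg.neg_part
  have fin1 : ∫⁻ x, ENNReal.ofReal (max (g x) 0) ∂μ ≠ ⊤ := (hp.lintegral_lt_top).ne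
  have fin2 : ∫⁻ x, ENNReal.ofReal (max (-g x) 0) ∂μ ≠ ⊤ := (hn.lintegral_lt_top).ne
  have : IsFiniteMeasure (μ.withDensity fun x => ENNReal.ofReal (max (g x) 0)) :=
    isFiniteMeasure_withDensity fin1
  have : IsFiniteMeasure (μ.withDensity fun x => ENNReal.ofReal (max (-g x) 0)) :=
    isFiniteMeasure_withDensity fin2
  have key : (μ.withDensity fun x => ENNReal.ofReal (max (g x) 0)) =
      μ.withDensity fun x => ENNReal.ofReal (max (-g x) 0) := by
    refine ext_of_resolventAlg fun r hr => ?_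
    rw [integral_withDensity_ofReal hp.1.aemeasurable (fun _ => le_max_right _ _),
      integral_withDensity_ofReal hn.1.aemeasurable (fun _ => le_max_right _ _), ← sub_eq_zero,
      ← integral_sub, ← h r hr]
    · refine integral_congr_ae (.of_forall fun x => ?_)
      simp only [← sub_mul, ← Complex.ofReal_sub]
      congr 2
      rcases le_total (g x) 0 with hx | hx
      · rw [max_eq_right hx, max_eq_left (by linarith)]; ring
      · rw [max_eq_left hx, max_eq_right (by linarith)]; ring
    · exact hp.ofReal.mul_bdd r.continuous.aestronglyMeasurable (.of_forall r.norm_coe_le_norm)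
    · exact hn.ofReal.mul_bdd r.continuous.aestronglyMeasurable (.of_forall r.norm_coe_le_norm)
  have := (withDensity_eq_iff hp.1.aemeasurable.ennreal_ofReal
    hn.1.aemeasurable.ennreal_ofReal fin1).1 key
  filter_upwards [this] with x hx
  rw [ENNReal.ofReal_eq_ofReal_iff (le_max_right _ _) (le_max_right _ _)] at hx
  rcases le_total (g x) 0 with hx' | hx'
  · rw [max_eq_right hx', max_eq_left (by linarith)] at hx
    simp only [Pi.zero_apply]; linarith
  · rw [max_eq_left hx', max_eq_right (by linarith)] at hx
    exact hx

/-- An integrable function which integrates to zero against the algebra generated by the resolvents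
vanishes. The algebra is closed under conjugation, so this may be checked for the real and imaginary
parts separately. -/
lemma ae_eq_zero_of_resolventAlg {μ : Measure ℝ} {g : ℝ → ℂ}
    (hg : Integrable g μ) (h : ∀ r ∈ resolventAlg, ∫ x, g x * r x ∂μ = 0) : g =ᵐ[μ] 0 := by
  have hi : ∀ r : ℝ →ᵇ ℂ, Integrable (fun x => g x * r x) μ := fun r =>
    hg.mul_bdd r.continuous.aestronglyMeasurable (.of_forall r.norm_coe_le_norm)
  have hconj : ∀ r ∈ resolventAlg, ∫ x, conj (g x) * r x ∂μ = 0 := by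
    intro r hr
    have := congrArg conj (h (star r) (star_mem hr))
    rw [← integral_conj] at this
    simpa using this
  have hi' : ∀ r : ℝ →ᵇ ℂ, Integrable (fun x => conj (g x) * r x) μ := fun r =>
    (Complex.conjCLE.toContinuousLinearMap.integrable_comp hg).mul_bdd
      r.continuous.aestronglyMeasurable (.of_forall r.norm_coe_le_norm)
  have h1 : (fun x => (g x).re) =ᵐ[μ] 0 := by
    refine ae_eq_zero_of_resolventAlg_real hg.re fun r hr => ?_
    have e : ∀ x, ((g x).re : ℂ) * r x = (1 / 2 : ℂ) * (g x * r x) + (1 / 2 : ℂ) * (conj (g x) * r x) := by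
      intro x
      rw [Complex.re_eq_add_conj]; ring
    simp only [e]
    rw [integral_add ((hi r).const_mul _) ((hi' r).const_mul _), integral_const_mul,
      integral_const_mul, h r hr, hconj r hr]
    simp
  have h2 : (fun x => (g x).im) =ᵐ[μ] 0 := by
    refine ae_eq_zero_of_resolventAlg_real hg.im fun r hr => ?_
    have e : ∀ x, ((g x).im : ℂ) * r x =
        (1 / (2 * I) : ℂ) * (g x * r x) + -(1 / (2 * I) : ℂ) * (conj (g x) * r x) := by
      intro x
      rw [Complex.im_eq_sub_conj]; ring
    simp only [e]
    rw [integral_add ((hi r).const_mul _) ((hi' r).const_mul _), integral_const_mul,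
      integral_const_mul, h r hr, hconj r hr]
    simp
  filter_upwards [h1, h2] with x hx1 hx2
  exact Complex.ext hx1 hx2

/-! ### Polynomial approximation and bounded point evaluation -/

/-- `f` is an `L²(μ)`-limit of polynomials. -/
def PolyApprox (μ : Measure ℝ) (f : ℝ → ℂ) : Prop :=
  MemLp f 2 μ ∧ ∀ ε > 0, ∃ P : ℂ[X], l2sq μ (fun x => f x - P.eval (x : ℂ)) < ε

/-- `1 / (x - i)` is an `L²(μ)`-limit of polynomials. By `PolyApprox.ae_eq_zero` this means that the
polynomials are dense in `L²(μ)`. -/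
def ResolventApprox (μ : Measure ℝ) : Prop := PolyApprox μ fun x => 1 / ((x : ℂ) - I)

/-- The evaluation of polynomials at `i` is bounded in the norm of `L²(μ)`. -/
def BoundedEval (μ : Measure ℝ) : Prop :=
  ∃ K : ℝ, ∀ P : ℂ[X], ‖P.eval I‖ ^ 2 ≤ K * l2sq μ (fun x => P.eval (x : ℂ))

variable {μ σ : Measure ℝ}

lemma memLp_fun_sub {f g : ℝ → ℂ} (hf : MemLp f 2 μ) (hg : MemLp g 2 μ) :
    MemLp (fun x => f x - g x) 2 μ := hf.sub hg

lemma integrable_fun_mul {f g : ℝ → ℂ} (hf : MemLp f 2 μ) (hg : MemLp g 2 μ) :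
    Integrable (fun x => f x * g x) μ := hf.integrable_mul hg

lemma memLp_resolvent [IsFiniteMeasure μ] {z : ℂ} (hz : z.im ≠ 0) :
    MemLp (fun x : ℝ => 1 / ((x : ℂ) - z)) 2 μ :=
  MemLp.of_bound (continuous_resolvent hz).aestronglyMeasurable _ (.of_forall (norm_resolvent_le hz))

lemma memLp_bcf_mul {f : ℝ → ℂ} (hf : MemLp f 2 μ) (r : ℝ →ᵇ ℂ) :
    MemLp (fun x => r x * f x) 2 μ := by
  refine (hf.const_mul (‖r‖ : ℂ)).mono (r.continuous.aestronglyMeasurable.mul hf.1)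
    (.of_forall fun x => ?_)
  rw [norm_mul, norm_mul]
  gcongr
  simpa using r.norm_coe_le_norm x

lemma memLp_resolvent_mul {f : ℝ → ℂ} (hf : MemLp f 2 μ) {z : ℂ} (hz : z.im ≠ 0) :
    MemLp (fun x : ℝ => 1 / ((x : ℂ) - z) * f x) 2 μ :=
  memLp_bcf_mul hf (resolventBCF z hz)

lemma PolyApprox.poly (hm : HasMoments μ) (P : ℂ[X]) : PolyApprox μ fun x => P.eval (x : ℂ) :=
  ⟨hm.memLp P, fun ε hε => ⟨P, by simpa [l2sq] using hε⟩⟩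

lemma PolyApprox.of_approx {f : ℝ → ℂ} (hf : MemLp f 2 μ)
    (h : ∀ ε > 0, ∃ g, PolyApprox μ g ∧ l2sq μ (fun x => f x - g x) < ε) (hm : HasMoments μ) :
    PolyApprox μ f := by
  refine ⟨hf, fun ε hε => ?_⟩
  obtain ⟨g, hg, hfg⟩ := h (ε / 4) (by positivity)
  obtain ⟨P, hP⟩ := hg.2 (ε / 4) (by positivity)
  refine ⟨P, ?_⟩
  have := l2sq_add_le (memLp_fun_sub hf hg.1) (memLp_fun_sub hg.1 (hm.memLp P))
  simp only [sub_add_sub_cancel] at this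
  linarith

lemma PolyApprox.add {f g : ℝ → ℂ} (hm : HasMoments μ) (hf : PolyApprox μ f) (hg : PolyApprox μ g) :
    PolyApprox μ fun x => f x + g x := by
  refine ⟨hf.1.add hg.1, fun ε hε => ?_⟩
  obtain ⟨P, hP⟩ := hf.2 (ε / 4) (by positivity)
  obtain ⟨Q, hQ⟩ := hg.2 (ε / 4) (by positivity)
  refine ⟨P + Q, ?_⟩
  have := l2sq_add_le (memLp_fun_sub hf.1 (hm.memLp P)) (memLp_fun_sub hg.1 (hm.memLp Q))
  simp only [eval_add, add_sub_add_comm]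
  linarith

lemma PolyApprox.const_mul {f : ℝ → ℂ} (hf : PolyApprox μ f) (c : ℂ) :
    PolyApprox μ fun x => c * f x := by
  refine ⟨hf.1.const_mul c, fun ε hε => ?_⟩
  obtain ⟨P, hP⟩ := hf.2 (ε / (‖c‖ ^ 2 + 1)) (by positivity)
  refine ⟨C c * P, ?_⟩
  simp only [eval_mul, eval_C, ← mul_sub]
  rw [l2sq_const_mul]
  rw [lt_div_iff₀ (by positivity)] at hP
  have := l2sq_nonneg μ (fun x => f x - P.eval (x : ℂ))
  linarith

lemma PolyApprox.conj {f : ℝ → ℂ} (hf : PolyApprox μ f) : PolyApprox μ fun x => conj (f x) := by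
  refine ⟨Complex.conjCLE.toContinuousLinearMap.comp_memLp' hf.1, fun ε hε => ?_⟩
  obtain ⟨P, hP⟩ := hf.2 ε hε
  refine ⟨conjPoly P, ?_⟩
  simpa only [l2sq, eval_conjPoly_ofReal, ← map_sub, Complex.norm_conj] using hP

lemma ResolventApprox.polyApprox (h : ResolventApprox μ) {z : ℂ} (hz : z = I ∨ z = -I) :
    PolyApprox μ fun x => 1 / ((x : ℂ) - z) := by
  rcases hz with rfl | rfl
  · exact h
  · simpa using PolyApprox.conj h

lemma exists_eval_eq_add (P : ℂ[X]) (z : ℂ) :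
    ∃ Q : ℂ[X], P = C (P.eval z) + (X - C z) * Q := by
  obtain ⟨Q, hQ⟩ := X_sub_C_dvd_sub_C_eval (a := z) (p := P)
  exact ⟨Q, by rw [← hQ]; ring⟩

/-- Limits of polynomials are closed under multiplication by a resolvent which is itself such a
limit, as `P / (x - z)` is a polynomial up to a multiple of `1 / (x - z)`. -/
lemma PolyApprox.resolvent_mul {f : ℝ → ℂ} (hm : HasMoments μ) (hf : PolyApprox μ f) {z : ℂ}
    (hz : z.im ≠ 0) (h : PolyApprox μ fun x => 1 / ((x : ℂ) - z)) :
    PolyApprox μ fun x => 1 / ((x : ℂ) - z) * f x := by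
  refine .of_approx (memLp_resolvent_mul hf.1 hz) (fun ε hε => ?_) hm
  obtain ⟨P, hP⟩ := hf.2 (ε * |z.im| ^ 2) (by have := abs_pos.2 hz; positivity)
  obtain ⟨Q, hQ⟩ := exists_eval_eq_add P z
  refine ⟨fun x => P.eval z * (1 / ((x : ℂ) - z)) + Q.eval (x : ℂ),
    (h.const_mul _).add hm (.poly hm Q), ?_⟩
  have e : ∀ x : ℝ, 1 / ((x : ℂ) - z) * f x - (P.eval z * (1 / ((x : ℂ) - z)) + Q.eval (x : ℂ)) =
      1 / ((x : ℂ) - z) * (f x - P.eval (x : ℂ)) := by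
    intro x
    have h0 := ofReal_sub_ne_zero hz x
    have : P.eval (x : ℂ) = P.eval z + ((x : ℂ) - z) * Q.eval (x : ℂ) := by
      conv_lhs => rw [hQ]
      simp
    rw [this]
    field_simp
  simp only [e]
  have hz' := abs_pos.2 hz
  calc _ ≤ l2sq μ (fun x => ((1 / |z.im| : ℝ) : ℂ) * (f x - P.eval (x : ℂ))) := by
        refine l2sq_mono ((hf.1.sub (hm.memLp P)).const_mul _) fun x => ?_
        rw [norm_mul, norm_mul, Complex.norm_real]
        gcongr
        rw [Real.norm_of_nonneg (by positivity)]
        exact norm_resolvent_le hz x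
    _ = (1 / |z.im|) ^ 2 * l2sq μ (fun x => f x - P.eval (x : ℂ)) := by
        rw [l2sq_const_mul, Complex.norm_real, Real.norm_of_nonneg (by positivity)]
    _ < (1 / |z.im|) ^ 2 * (ε * |z.im| ^ 2) := by gcongr
    _ = ε := by field_simp

lemma ResolventApprox.polyApprox_mul (hm : HasMoments μ) (h : ResolventApprox μ) :
    ∀ r ∈ resolventAlg, ∀ f, PolyApprox μ f → PolyApprox μ fun x => r x * f x := by
  refine resolventAlg_induction (fun z hz hz' f hf => hf.resolvent_mul hm hz (h.polyApprox hz'))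
    (fun c f hf => hf.const_mul c) (fun r s hr hs f hf => ?_) fun r s hr hs f hf => ?_
  · simpa [add_mul] using (hr f hf).add hm (hs f hf)
  · simpa [mul_assoc] using hr _ (hs f hf)

lemma ResolventApprox.polyApprox_alg (hm : HasMoments μ) (h : ResolventApprox μ) :
    ∀ r ∈ resolventAlg, PolyApprox μ r := by
  intro r hr
  simpa using h.polyApprox_mul hm r hr _ (.poly hm 1)

lemma integral_mul_eq_zero_of_polyApprox (hm : HasMoments μ) {w f : ℝ → ℂ} (hw : MemLp w 2 μ)
    (h : ∀ P : ℂ[X], ∫ x, w x * P.eval (x : ℂ) ∂μ = 0) (hf : PolyApprox μ f) :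
    ∫ x, w x * f x ∂μ = 0 := by
  by_contra hne
  have hpos : 0 < ‖∫ x, w x * f x ∂μ‖ ^ 2 := by positivity
  obtain ⟨P, hP⟩ := hf.2 (‖∫ x, w x * f x ∂μ‖ ^ 2 / (l2sq μ w + 1))
    (by have := l2sq_nonneg μ w; positivity)
  have e : ∫ x, w x * f x ∂μ = ∫ x, w x * (f x - P.eval (x : ℂ)) ∂μ := by
    simp only [mul_sub]
    rw [integral_sub (integrable_fun_mul hw hf.1) (integrable_fun_mul hw (hm.memLp P)), h, sub_zero]
  have := norm_integral_mul_sq_le hw (memLp_fun_sub hf.1 (hm.memLp P))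
  rw [← e] at this
  rw [lt_div_iff₀ (by have := l2sq_nonneg μ w; positivity)] at hP
  have h1 := l2sq_nonneg μ w
  have h2 := l2sq_nonneg μ (fun x => f x - P.eval (x : ℂ))
  nlinarith

/-- If `1 / (x - i)` is a limit of polynomials, then the polynomials are dense in `L²(μ)`: a function
orthogonal to them vanishes. -/
lemma ResolventApprox.ae_eq_zero (hm : HasMoments μ) (h : ResolventApprox μ) {w : ℝ → ℂ}
    (hw : MemLp w 2 μ) (hP : ∀ P : ℂ[X], ∫ x, w x * P.eval (x : ℂ) ∂μ = 0) : w =ᵐ[μ] 0 := by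
  have := hm.isFiniteMeasure
  exact ae_eq_zero_of_resolventAlg (hw.integrable (by norm_num)) fun r hr =>
    integral_mul_eq_zero_of_polyApprox hm hw hP (h.polyApprox_alg hm r hr)

lemma l2sq_mono_measure (hle : μ ≤ σ) {f : ℝ → ℂ} (hf : MemLp f 2 σ) : l2sq μ f ≤ l2sq σ f :=
  integral_mono_measure hle (.of_forall fun _ => by positivity)
    ((memLp_two_iff_integrable_sq_norm hf.1).1 hf)

lemma ResolventApprox.mono_measure (hσ : HasMoments σ) (h : ResolventApprox σ) (hle : μ ≤ σ) :
    ResolventApprox μ := by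
  refine ⟨h.1.mono_measure hle, fun ε hε => ?_⟩
  obtain ⟨P, hP⟩ := h.2 ε hε
  exact ⟨P, (l2sq_mono_measure hle (h.1.sub (hσ.memLp P))).trans_lt hP⟩

lemma BoundedEval.mono_measure (hσ : HasMoments σ) (h : BoundedEval μ) (hle : μ ≤ σ) :
    BoundedEval σ := by
  obtain ⟨K, hK⟩ := h
  refine ⟨max K 0, fun P => (hK P).trans ?_⟩
  have := l2sq_mono_measure hle (hσ.memLp P)
  have := l2sq_nonneg μ (fun x => P.eval (x : ℂ))
  calc _ ≤ max K 0 * l2sq μ (fun x => P.eval (x : ℂ)) := by gcongr; exact le_max_left _ _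
    _ ≤ _ := by gcongr

lemma not_boundedEval_iff : ¬ BoundedEval μ ↔
    ∀ ε > 0, ∃ P : ℂ[X], P.eval I = 1 ∧ l2sq μ (fun x => P.eval (x : ℂ)) < ε := by
  constructor
  · intro h ε hε
    simp only [BoundedEval, not_exists, not_forall, not_le] at h
    obtain ⟨P, hP⟩ := h (1 / ε)
    have h0 := l2sq_nonneg μ (fun x => P.eval (x : ℂ))
    have hpos : 0 < ‖P.eval I‖ ^ 2 := lt_of_le_of_lt (by positivity) hP
    have hne : P.eval I ≠ 0 := by
      intro h; simp [h] at hpos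
    refine ⟨C (P.eval I)⁻¹ * P, by simp [hne], ?_⟩
    simp only [eval_mul, eval_C]
    rw [l2sq_const_mul, norm_inv, inv_pow, inv_mul_lt_iff₀ hpos]
    rw [one_div, inv_mul_lt_iff₀ hε] at hP
    linarith
  · rintro h ⟨K, hK⟩
    obtain ⟨P, hP, hlt⟩ := h (1 / (|K| + 1)) (by positivity)
    have := hK P
    rw [hP, norm_one, one_pow] at this
    have h0 := l2sq_nonneg μ (fun x => P.eval (x : ℂ))
    rw [lt_div_iff₀ (by positivity)] at hlt
    nlinarith [le_abs_self K]

lemma moment_eq_integral_eval (hμ : HasMoments μ) (hσ : HasMoments σ)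
    (h : ∀ n, moment σ n = moment μ n) (P : ℝ[X]) : ∫ x, P.eval x ∂σ = ∫ x, P.eval x ∂μ := by
  simp only [eval_eq_sum_range]
  rw [integral_finsetSum _ fun i _ => (hσ i).const_mul _,
    integral_finsetSum _ fun i _ => (hμ i).const_mul _]
  simp only [integral_const_mul]
  exact Finset.sum_congr rfl fun i _ => by rw [← moment, ← moment, h]

lemma moment_eq_integral_ceval (hμ : HasMoments μ) (hσ : HasMoments σ)
    (h : ∀ n, moment σ n = moment μ n) (P : ℂ[X]) :
    ∫ x, P.eval (x : ℂ) ∂σ = ∫ x, P.eval (x : ℂ) ∂μ := by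
  obtain ⟨P₁, P₂, rfl⟩ := exists_real_polys P
  simp only [eval_add, eval_mul, eval_C, eval_map_ofReal]
  rw [integral_add (hσ.integrable_eval P₁).ofReal ((hσ.integrable_eval P₂).ofReal.const_mul _),
    integral_add (hμ.integrable_eval P₁).ofReal ((hμ.integrable_eval P₂).ofReal.const_mul _)]
  simp only [integral_const_mul, integral_complex_ofReal, moment_eq_integral_eval hμ hσ h]

lemma l2sq_eval_eq (hμ : HasMoments μ) (hσ : HasMoments σ)
    (h : ∀ n, moment σ n = moment μ n) (P : ℂ[X]) :
    l2sq σ (fun x => P.eval (x : ℂ)) = l2sq μ (fun x => P.eval (x : ℂ)) := by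
  obtain ⟨Q, hQ⟩ := exists_normSq_poly P
  simp only [l2sq, hQ, moment_eq_integral_eval hμ hσ h]

lemma l2sq_add_measure {f : ℝ → ℂ} (hf : MemLp f 2 (μ + σ)) :
    l2sq (μ + σ) f = l2sq μ f + l2sq σ f := by
  have h := (memLp_two_iff_integrable_sq_norm hf.1).1 hf
  exact integral_add_measure (h.mono_measure (Measure.le_add_right le_rfl))
    (h.mono_measure (Measure.le_add_left le_rfl))

/-- If point evaluation at `i` is unbounded, polynomials `P` with `P(i) = 1` and small `L²(μ)`-norm
have a small norm in `L²(σ)` for every solution `σ` of the moment problem. Hence `1 / (x - i)` is a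
limit of polynomials in `L²(μ + σ)`, and `μ` and `σ` have the same integrals over the algebra
generated by the resolvents. -/
lemma eq_of_not_boundedEval (hμ : HasMoments μ) (hσ : HasMoments σ)
    (h : ∀ n, moment σ n = moment μ n) (hE : ¬ BoundedEval μ) : σ = μ := by
  have := hμ.isFiniteMeasure
  have := hσ.isFiniteMeasure
  have hm := hμ.add hσ
  have hA : ResolventApprox (μ + σ) := by
    refine ⟨memLp_resolvent (by simp), fun ε hε => ?_⟩
    obtain ⟨P, hP, hlt⟩ := not_boundedEval_iff.1 hE (ε / 2) (by positivity)
    obtain ⟨Q, hQ⟩ := exists_eval_eq_add P I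
    refine ⟨-Q, ?_⟩
    calc _ ≤ l2sq (μ + σ) (fun x => P.eval (x : ℂ)) := by
          refine l2sq_mono (hm.memLp P) fun x => ?_
          have h0 := ofReal_sub_ne_zero (z := I) (by simp) x
          have e : 1 / ((x : ℂ) - I) - (-Q).eval (x : ℂ) = 1 / ((x : ℂ) - I) * P.eval (x : ℂ) := by
            have : P.eval (x : ℂ) = 1 + ((x : ℂ) - I) * Q.eval (x : ℂ) := by
              rw [← hP]; conv_lhs => rw [hQ]
              simp
            rw [this, eval_neg]
            field_simp
            ring
          rw [e, norm_mul]
          have := norm_resolvent_le (z := I) (by simp) x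
          simp only [Complex.I_im, abs_one, div_one] at this
          exact mul_le_of_le_one_left (norm_nonneg _) this
      _ = 2 * l2sq μ (fun x => P.eval (x : ℂ)) := by
          rw [l2sq_add_measure (hm.memLp P), l2sq_eval_eq hμ hσ h]; ring
      _ < ε := by linarith
  refine ext_of_resolventAlg fun r hr => ?_
  have hr := hA.polyApprox_alg hm r hr
  rw [← sub_eq_zero, ← norm_le_zero_iff]
  refine le_of_forall_pos_le_add fun ε hε => ?_
  rw [zero_add]
  have h1 : MemLp (fun _ : ℝ => (1 : ℂ)) 2 (μ + σ) := memLp_const 1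
  set K := l2sq (μ + σ) fun _ => 1
  have hK := l2sq_nonneg (μ + σ) fun _ => 1
  obtain ⟨P, hP⟩ := hr.2 ((ε / 2) ^ 2 / (K + 1)) (by positivity)
  have hlt : K * l2sq (μ + σ) (fun x => r x - P.eval (x : ℂ)) ≤ (ε / 2) ^ 2 := by
    rw [lt_div_iff₀ (by positivity)] at hP
    have := l2sq_nonneg (μ + σ) (fun x => r x - P.eval (x : ℂ))
    linarith
  have key : ∀ τ : Measure ℝ, τ ≤ μ + σ → HasMoments τ → IsFiniteMeasure τ →
      ‖∫ x, r x ∂τ - ∫ x, P.eval (x : ℂ) ∂τ‖ ≤ ε / 2 := by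
    intro τ hτ hmτ hfin
    rw [← integral_sub (r.integrable τ) (hmτ.integrable_ceval P)]
    have hd := memLp_fun_sub hr.1 (hm.memLp P)
    have := norm_integral_mul_sq_le (h1.mono_measure hτ) (hd.mono_measure hτ)
    simp only [one_mul] at this
    refine le_of_sq_le_sq ?_ (by positivity)
    refine this.trans (le_trans ?_ hlt)
    have a1 := l2sq_mono_measure hτ h1
    have a2 := l2sq_mono_measure hτ hd
    exact mul_le_mul a1 a2 (l2sq_nonneg _ _) hK
  have k1 := key σ (Measure.le_add_left le_rfl) hσ inferInstance
  have k2 := key μ (Measure.le_add_right le_rfl) hμ inferInstance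
  rw [moment_eq_integral_ceval hμ hσ h] at k1
  rw [norm_sub_rev] at k2
  calc _ = ‖(∫ x, r x ∂σ - ∫ x, P.eval (x : ℂ) ∂μ) + (∫ x, P.eval (x : ℂ) ∂μ - ∫ x, r x ∂μ)‖ := by
        congr 1; ring
    _ ≤ _ := norm_add_le _ _
    _ ≤ _ := by linarith

/-! ### Nonnegative polynomials on the line -/

lemma conjPoly_mul (P Q : ℂ[X]) : conjPoly (P * Q) = conjPoly P * conjPoly Q :=
  Polynomial.map_mul _

lemma eval_nonneg_of_dense {Q : ℝ[X]} {r : ℝ} (h : ∀ x, x ≠ r → 0 ≤ Q.eval x) (x : ℝ) :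
    0 ≤ Q.eval x := by
  have hd : Dense {r}ᶜ := dense_compl_singleton r
  have : IsClosed {x : ℝ | 0 ≤ Q.eval x} := isClosed_le continuous_const Q.continuous
  exact (this.closure_subset_iff.2 fun y hy => h y hy) (hd x)

/-- A real polynomial which is nonnegative on the real line is `|S|²` there for some complex
polynomial `S`. -/
lemma exists_eq_mul_conjPoly (P : ℝ[X]) (hP : ∀ x, 0 ≤ P.eval x) :
    ∃ S : ℂ[X], P.map Complex.ofRealHom = S * conjPoly S := by
  induction hn : P.natDegree using Nat.strong_induction_on generalizing P with
  | _ n ih =>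
  rcases Nat.eq_zero_or_pos n with rfl | hpos
  · rw [natDegree_eq_zero] at hn
    obtain ⟨c, rfl⟩ := hn
    refine ⟨C (√c : ℂ), ?_⟩
    have hc : 0 ≤ c := by simpa using hP 0
    simp only [map_C, conjPoly, ← C_mul, Complex.ofRealHom_eq_coe, Complex.conj_ofReal,
      ← Complex.ofReal_mul, Real.mul_self_sqrt hc]
  · have hP0 : P ≠ 0 := by rintro rfl; simp at hn; omega
    obtain ⟨z, hz⟩ := Complex.exists_root (f := P.map Complex.ofRealHom) (by
      rw [degree_map]; exact natDegree_pos_iff_degree_pos.1 (hn ▸ hpos))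
    rw [IsRoot] at hz
    by_cases hz' : z.im = 0
    · obtain ⟨r, rfl⟩ : ∃ r : ℝ, (r : ℂ) = z := ⟨z.re, Complex.ext rfl (by simp [hz'])⟩
      rw [eval_map_ofReal, Complex.ofReal_eq_zero] at hz
      obtain ⟨Q, rfl⟩ := dvd_iff_isRoot.2 hz
      -- `Q` changes its sign at `r`, so that `r` is a double root
      have hQr : Q.eval r = 0 := by
        apply le_antisymm
        · refine le_of_tendsto (Q.continuous.tendsto r |>.mono_left (nhdsWithin_le_nhds (s := Set.Iio r))) ?_
          filter_upwards [self_mem_nhdsWithin] with x hx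
          have := hP x
          simp only [eval_mul, eval_sub, eval_X, eval_C] at this
          exact nonpos_of_mul_nonneg_right this (sub_neg.2 hx)
        · refine ge_of_tendsto (Q.continuous.tendsto r |>.mono_left (nhdsWithin_le_nhds (s := Set.Ioi r))) ?_
          filter_upwards [self_mem_nhdsWithin] with x hx
          have := hP x
          simp only [eval_mul, eval_sub, eval_X, eval_C] at this
          exact nonneg_of_mul_nonneg_right this (sub_pos.2 hx)
      obtain ⟨R, rfl⟩ := dvd_iff_isRoot.2 hQr
      have hR : R ≠ 0 := by rintro rfl; simp at hP0
      obtain ⟨S, hS⟩ := ih R.natDegree (by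
        rw [← hn, natDegree_mul (X_sub_C_ne_zero r) (by simpa [X_sub_C_ne_zero] using hR),
          natDegree_mul (X_sub_C_ne_zero r) hR, natDegree_X_sub_C]; omega) R
        (eval_nonneg_of_dense (r := r) fun x hx => by
          have := hP x
          simp only [eval_mul, eval_sub, eval_X, eval_C, ← mul_assoc] at this
          exact nonneg_of_mul_nonneg_right this (mul_self_pos.2 (sub_ne_zero.2 hx))) rfl
      refine ⟨(X - C (r : ℂ)) * S, ?_⟩
      rw [conjPoly_mul, Polynomial.map_mul, Polynomial.map_mul, hS]
      simp only [conjPoly, Polynomial.map_sub, map_X, map_C, Complex.conj_ofReal,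
        Complex.ofRealHom_eq_coe]
      ring
    · obtain ⟨Q, rfl⟩ := P.quadratic_dvd_of_aeval_eq_zero_im_ne_zero (z := z)
        (by rw [aeval_def, ← eval_map]; exact hz) hz'
      set q : ℝ[X] := X ^ 2 - C (2 * z.re) * X + C (‖z‖ ^ 2) with hq
      have hqm : q.map Complex.ofRealHom = (X - C z) * (X - C (conj z)) := by
        have h1 : ((2 * z.re : ℝ) : ℂ) = z + conj z := by rw [Complex.add_conj]
        have h2 : ((‖z‖ ^ 2 : ℝ) : ℂ) = z * conj z := by rw [Complex.mul_conj, Complex.normSq_eq_norm_sq]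
        simp only [hq, Polynomial.map_add, Polynomial.map_sub, Polynomial.map_mul, Polynomial.map_pow,
          map_X, map_C, Complex.ofRealHom_eq_coe]
        rw [h1, h2, C_add, C_mul]
        ring
      have hqe : ∀ x : ℝ, 0 < q.eval x := by
        intro x
        have : q.eval x = ‖(x : ℂ) - z‖ ^ 2 := by
          have h := congrArg (eval (x : ℂ)) hqm
          rw [eval_map_ofReal] at h
          rw [← Complex.ofReal_inj, h, ← Complex.normSq_eq_norm_sq, ← Complex.mul_conj]
          simp
        rw [this]
        have := norm_pos_iff.2 (ofReal_sub_ne_zero hz' x)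
        positivity
      have hQ : Q ≠ 0 := by rintro rfl; simp at hP0
      have hq0 : q ≠ 0 := by rintro h; have := hqe 0; simp [h] at this
      have hdeg : q.natDegree = 2 := by
        have := natDegree_map_eq_of_injective Complex.ofRealHom.injective q
        rw [← this, hqm, natDegree_mul (X_sub_C_ne_zero _) (X_sub_C_ne_zero _)]; simp
      obtain ⟨S, hS⟩ := ih Q.natDegree (by rw [← hn, natDegree_mul hq0 hQ]; omega) Q (fun x => by
        have := hP x
        rw [eval_mul] at this
        exact nonneg_of_mul_nonneg_right this (hqe x)) rfl
      refine ⟨(X - C z) * S, ?_⟩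
      rw [conjPoly_mul, Polynomial.map_mul, hS, hqm]
      simp only [conjPoly, Polynomial.map_sub, map_X, map_C]
      ring

/-- The factor can be chosen such that its value at `i` is not larger than `1`, since it may be
conjugated. -/
lemma exists_factor_small {P : ℝ[X]} (hP : ∀ x, 0 ≤ P.eval x) {c : ℂ}
    (h : (P.map Complex.ofRealHom).eval I = c) (hc : ‖c‖ = 1) :
    ∃ S : ℂ[X], ‖S.eval I‖ ≤ 1 ∧ S.eval I * conj (S.eval (-I)) = c ∧
      ∀ x : ℝ, ‖S.eval (x : ℂ)‖ ^ 2 = P.eval x := by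
  obtain ⟨S, hS⟩ := exists_eq_mul_conjPoly P hP
  have hn : ∀ x : ℝ, ‖S.eval (x : ℂ)‖ ^ 2 = P.eval x := by
    intro x
    have := congrArg (eval (x : ℂ)) hS
    rw [eval_map_ofReal, eval_mul, eval_conjPoly_ofReal, Complex.mul_conj,
      Complex.normSq_eq_norm_sq] at this
    exact_mod_cast this.symm
  have hc' : S.eval I * conj (S.eval (-I)) = c := by
    rw [← h, hS, eval_mul, eval_conjPoly, Complex.conj_I]
  by_cases h1 : ‖S.eval I‖ ≤ 1
  · exact ⟨S, h1, hc', hn⟩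
  · refine ⟨conjPoly S, ?_, ?_, fun x => by rw [eval_conjPoly_ofReal, Complex.norm_conj, hn]⟩
    · rw [eval_conjPoly, Complex.norm_conj, Complex.conj_I]
      have := congrArg norm hc'
      rw [norm_mul, Complex.norm_conj, hc] at this
      push Not at h1
      by_contra! h2
      nlinarith
    · rw [eval_conjPoly, eval_conjPoly, map_neg, Complex.conj_I, neg_neg, Complex.conj_conj, mul_comm,
        hc']

/-- Evaluation at `i` is unbounded as soon as `x / (1 + x²)` can be squeezed between polynomials with
arbitrarily close integrals. -/
lemma not_boundedEval_of_squeeze {μ : Measure ℝ} (hm : HasMoments μ)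
    (h : ∀ ε > 0, ∃ P Q : ℝ[X], (∀ x, Q.eval x ≤ x / (1 + x ^ 2)) ∧
      (∀ x, x / (1 + x ^ 2) ≤ P.eval x) ∧ ∫ x, P.eval x ∂μ - ∫ x, Q.eval x ∂μ < ε) :
    ¬ BoundedEval μ := by
  rintro ⟨K, hK⟩
  obtain ⟨P, Q, hQ, hP, hlt⟩ := h (1 / (4 * (|K| + 1))) (by positivity)
  have hpos : ∀ x : ℝ, 0 < 1 + x ^ 2 := fun x => by positivity
  obtain ⟨S, hS1, hSc, hSn⟩ := exists_factor_small (P := (1 + X ^ 2) * P - X) (c := -I) (fun x => by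
      have := hP x
      rw [div_le_iff₀ (hpos x)] at this
      simp; linarith) (by simp) (by simp)
  obtain ⟨T, hT1, hTc, hTn⟩ := exists_factor_small (P := X - (1 + X ^ 2) * Q) (c := I) (fun x => by
      have := hQ x
      rw [le_div_iff₀ (hpos x)] at this
      simp; linarith) (by simp) (by simp)
  obtain ⟨V, hV⟩ := exists_eval_eq_add (C (T.eval I) * S - C (S.eval I) * T) I
  have e0 : (C (T.eval I) * S - C (S.eval I) * T).eval I = 0 := by simp; ring
  rw [e0, C_0, zero_add] at hV
  have hVe : ∀ z, T.eval I * S.eval z - S.eval I * T.eval z = (z - I) * V.eval z := by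
    intro z
    have := congrArg (eval z) hV
    simpa using this
  have hVn : l2sq μ (fun x => V.eval (x : ℂ)) ≤ 2 * (∫ x, P.eval x ∂μ - ∫ x, Q.eval x ∂μ) := by
    rw [← integral_sub (hm.integrable_eval P) (hm.integrable_eval Q), ← integral_const_mul]
    refine integral_mono ((memLp_two_iff_integrable_sq_norm (hm.memLp V).1).1 (hm.memLp V))
      (((hm.integrable_eval P).sub (hm.integrable_eval Q)).const_mul _) fun x => ?_
    simp only
    have h1 : ‖(x : ℂ) - I‖ ^ 2 = 1 + x ^ 2 := by
      rw [← Complex.normSq_eq_norm_sq, Complex.normSq_apply]; simp; ring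
    have h2 := congrArg (fun w => ‖w‖ ^ 2) (hVe x)
    simp only [norm_mul, mul_pow, h1] at h2
    have h3 : ‖T.eval I * S.eval (x : ℂ) - S.eval I * T.eval (x : ℂ)‖ ≤
        ‖S.eval (x : ℂ)‖ + ‖T.eval (x : ℂ)‖ := by
      refine (norm_sub_le _ _).trans ?_
      rw [norm_mul, norm_mul]
      gcongr <;> exact mul_le_of_le_one_left (norm_nonneg _) ‹_›
    have h4 : ‖T.eval I * S.eval (x : ℂ) - S.eval I * T.eval (x : ℂ)‖ ^ 2 ≤
        2 * (‖S.eval (x : ℂ)‖ ^ 2 + ‖T.eval (x : ℂ)‖ ^ 2) := by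
      have := norm_nonneg (T.eval I * S.eval (x : ℂ) - S.eval I * T.eval (x : ℂ))
      nlinarith [sq_nonneg (‖S.eval (x : ℂ)‖ - ‖T.eval (x : ℂ)‖)]
    rw [h2, hSn, hTn] at h4
    simp only [eval_sub, eval_mul, eval_add, eval_one, eval_pow, eval_X] at h4
    refine le_of_mul_le_mul_left ?_ (hpos x)
    linarith
  have hVI : 1 ≤ ‖V.eval (-I)‖ := by
    have n1 : ‖S.eval I‖ * ‖S.eval (-I)‖ = 1 := by
      simpa using congrArg norm hSc
    have n2 : ‖T.eval I‖ * ‖T.eval (-I)‖ = 1 := by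
      simpa using congrArg norm hTc
    have hs' : S.eval (-I) = I * S.eval I * (‖S.eval (-I)‖ ^ 2 : ℝ) := by
      rw [← Complex.normSq_eq_norm_sq, ← Complex.mul_conj]
      linear_combination (-I * S.eval (-I)) * hSc + S.eval (-I) * Complex.I_sq
    have ht' : T.eval (-I) = -I * T.eval I * (‖T.eval (-I)‖ ^ 2 : ℝ) := by
      rw [← Complex.normSq_eq_norm_sq, ← Complex.mul_conj]
      linear_combination (I * T.eval (-I)) * hTc + T.eval (-I) * Complex.I_sq
    have e1 := hVe (-I)
    have e2 : T.eval I * S.eval (-I) - S.eval I * T.eval (-I) =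
        I * (S.eval I * T.eval I) * ((‖S.eval (-I)‖ ^ 2 + ‖T.eval (-I)‖ ^ 2 : ℝ) : ℂ) := by
      push_cast at hs' ht' ⊢
      linear_combination T.eval I * hs' - S.eval I * ht'
    rw [e2] at e1
    have e3 := congrArg norm e1
    have n3 : ‖-I - I‖ = 2 := by
      rw [show -I - I = (-2 : ℝ) * I by push_cast; ring, norm_mul, Complex.norm_real]; simp
    rw [norm_mul, norm_mul, norm_mul, norm_mul, n3, Complex.norm_real, Complex.norm_I, one_mul,
      Real.norm_of_nonneg (by positivity)] at e3
    have : ‖S.eval I‖ * ‖T.eval I‖ * (2 * ‖S.eval (-I)‖ * ‖T.eval (-I)‖) ≤ 2 * ‖V.eval (-I)‖ := by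
      rw [← e3]
      gcongr
      nlinarith [sq_nonneg (‖S.eval (-I)‖ - ‖T.eval (-I)‖)]
    have n4 : ‖S.eval I‖ * ‖T.eval I‖ * (2 * ‖S.eval (-I)‖ * ‖T.eval (-I)‖) = 2 := by
      linear_combination 2 * ‖T.eval I‖ * ‖T.eval (-I)‖ * n1 + 2 * n2
    linarith
  have := hK (conjPoly V)
  rw [eval_conjPoly, Complex.norm_conj, Complex.conj_I] at this
  have e : l2sq μ (fun x => (conjPoly V).eval (x : ℂ)) = l2sq μ (fun x => V.eval (x : ℂ)) := by
    simp only [l2sq, eval_conjPoly_ofReal, Complex.norm_conj]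
  rw [e] at this
  rw [lt_div_iff₀ (by positivity)] at hlt
  have h0 := l2sq_nonneg μ (fun x => V.eval (x : ℂ))
  have h1 : 1 ≤ ‖V.eval (-I)‖ ^ 2 := by nlinarith
  nlinarith [le_abs_self K, abs_nonneg K, mul_le_mul_of_nonneg_right (le_abs_self K) h0,
    mul_le_mul_of_nonneg_left hVn (abs_nonneg K)]

/-! ### Determinate measures and one-sided approximation -/

/-- The continuous functions which are bounded by a polynomial. -/
def polyBdd : Submodule ℝ C(ℝ, ℝ) where
  carrier := {g | ∃ P : ℝ[X], ∀ x, |g x| ≤ P.eval x}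
  zero_mem' := ⟨0, by simp⟩
  add_mem' := by
    rintro f g ⟨P, hP⟩ ⟨Q, hQ⟩
    exact ⟨P + Q, fun x => (abs_add_le _ _).trans (by rw [eval_add]; exact add_le_add (hP x) (hQ x))⟩
  smul_mem' := by
    rintro c g ⟨P, hP⟩
    refine ⟨C |c| * P, fun x => ?_⟩
    simp only [ContinuousMap.coe_smul, Pi.smul_apply, smul_eq_mul, abs_mul, eval_mul, eval_C]
    gcongr
    exact hP x

/-- The upper integral `inf {∫ P dμ : P ≥ g}`, over the polynomials above `g`. -/
def upperInt (μ : Measure ℝ) (g : polyBdd) : ℝ :=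
  sInf {s | ∃ P : ℝ[X], (∀ x, g.1 x ≤ P.eval x) ∧ s = ∫ x, P.eval x ∂μ}


lemma upperInt_nonempty (μ : Measure ℝ) (g : polyBdd) :
    {s | ∃ P : ℝ[X], (∀ x, g.1 x ≤ P.eval x) ∧ s = ∫ x, P.eval x ∂μ}.Nonempty := by
  obtain ⟨P, hP⟩ := g.2
  exact ⟨_, P, fun x => (le_abs_self _).trans (hP x), rfl⟩

lemma upperInt_bddBelow {μ : Measure ℝ} (hm : HasMoments μ) (g : polyBdd) :
    BddBelow {s | ∃ P : ℝ[X], (∀ x, g.1 x ≤ P.eval x) ∧ s = ∫ x, P.eval x ∂μ} := by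
  obtain ⟨Q, hQ⟩ := g.2
  refine ⟨∫ x, (-Q).eval x ∂μ, ?_⟩
  rintro _ ⟨P, hP, rfl⟩
  refine integral_mono (hm.integrable_eval _) (hm.integrable_eval _) fun x => ?_
  have h1 := hQ x
  have h2 := hP x
  have h3 := neg_abs_le (g.1 x)
  simp only [eval_neg]
  linarith

lemma upperInt_le {μ : Measure ℝ} (hm : HasMoments μ) {g : polyBdd} {P : ℝ[X]}
    (h : ∀ x, g.1 x ≤ P.eval x) : upperInt μ g ≤ ∫ x, P.eval x ∂μ :=
  csInf_le (upperInt_bddBelow hm g) ⟨P, h, rfl⟩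

lemma exists_lt_upperInt (μ : Measure ℝ) (g : polyBdd) {ε : ℝ} (hε : 0 < ε) :
    ∃ P : ℝ[X], (∀ x, g.1 x ≤ P.eval x) ∧ ∫ x, P.eval x ∂μ < upperInt μ g + ε := by
  obtain ⟨_, ⟨P, hP, rfl⟩, hlt⟩ := exists_lt_of_csInf_lt (upperInt_nonempty μ g)
    (lt_add_of_pos_right (upperInt μ g) hε)
  exact ⟨P, hP, hlt⟩

lemma upperInt_add {μ : Measure ℝ} (hm : HasMoments μ) (f g : polyBdd) :
    upperInt μ (f + g) ≤ upperInt μ f + upperInt μ g := by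
  refine le_of_forall_pos_le_add fun ε hε => ?_
  obtain ⟨P, hP, hP'⟩ := exists_lt_upperInt μ f (half_pos hε)
  obtain ⟨Q, hQ, hQ'⟩ := exists_lt_upperInt μ g (half_pos hε)
  have := upperInt_le hm (g := f + g) (P := P + Q) fun x => by
    rw [eval_add]; exact add_le_add (hP x) (hQ x)
  simp only [eval_add] at this
  rw [integral_add (hm.integrable_eval _) (hm.integrable_eval _)] at this
  linarith

lemma upperInt_smul_le {μ : Measure ℝ} (hm : HasMoments μ) {c : ℝ} (hc : 0 < c) (g : polyBdd) :
    upperInt μ (c • g) ≤ c * upperInt μ g := by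
  refine le_of_forall_pos_le_add fun ε hε => ?_
  obtain ⟨P, hP, hP'⟩ := exists_lt_upperInt μ g (div_pos hε hc)
  have := upperInt_le hm (g := c • g) (P := C c * P) fun x => by
    simp only [eval_mul, eval_C, Submodule.coe_smul, ContinuousMap.coe_smul, Pi.smul_apply,
      smul_eq_mul]
    exact mul_le_mul_of_nonneg_left (hP x) hc.le
  simp only [eval_mul, eval_C, integral_const_mul] at this
  calc _ ≤ _ := this
    _ ≤ c * (upperInt μ g + ε / c) := by gcongr
    _ = _ := by field_simp

lemma upperInt_smul {μ : Measure ℝ} (hm : HasMoments μ) {c : ℝ} (hc : 0 < c) (g : polyBdd) :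
    upperInt μ (c • g) = c * upperInt μ g := by
  refine le_antisymm (upperInt_smul_le hm hc g) ?_
  have := upperInt_smul_le hm (inv_pos.2 hc) (c • g)
  rw [smul_smul, inv_mul_cancel₀ hc.ne', one_smul] at this
  rwa [inv_mul_eq_div, le_div_iff₀' hc] at this

/-- By the Hahn–Banach theorem, the functional `∫ P dμ` on polynomials extends to a positive
functional which takes the largest possible value at `f`. -/
lemma exists_extension {μ : Measure ℝ} (hm : HasMoments μ) {f : polyBdd} (hf : f ≠ 0) :
    ∃ L : polyBdd →ₗ[ℝ] ℝ, L f = upperInt μ f ∧ ∀ g, L g ≤ upperInt μ g := by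
  have h0 : upperInt μ 0 = 0 := by
    have := upperInt_smul hm two_pos (0 : polyBdd)
    rw [smul_zero] at this
    linarith
  obtain ⟨L, hL, hL'⟩ := exists_extension_of_le_sublinear
    (LinearPMap.mkSpanSingleton (K := ℝ) f (upperInt μ f) hf) (upperInt μ)
    (fun c hc => upperInt_smul hm hc) (upperInt_add hm) (by
      rintro ⟨x, hx⟩
      obtain ⟨c, rfl⟩ := Submodule.mem_span_singleton.1 hx
      refine le_of_eq_of_le (LinearPMap.mkSpanSingleton'_apply f (upperInt μ f) _ c _) ?_
      rw [RingHom.id_apply, smul_eq_mul]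
      rcases lt_trichotomy c 0 with hc | rfl | hc
      · have h1 := upperInt_add hm (c • f) ((-c) • f)
        rw [← add_smul, add_neg_cancel, zero_smul, h0, upperInt_smul hm (neg_pos.2 hc)] at h1
        simp only
        linarith
      · simp [h0]
      · exact (upperInt_smul hm hc f).ge)
  refine ⟨L, ?_, hL'⟩
  have := hL ⟨f, Submodule.mem_span_singleton_self f⟩
  rw [this, LinearPMap.mkSpanSingleton_apply]

/-- A polynomial as an element of `polyBdd`. -/
def polyElem (P : ℝ[X]) : polyBdd :=
  ⟨⟨fun x => P.eval x, P.continuous⟩, P ^ 2 + 1, fun x => by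
    simp only [ContinuousMap.coe_mk, eval_add, eval_pow, eval_one]
    nlinarith [sq_abs (P.eval x), sq_nonneg (|P.eval x| - 1), abs_nonneg (P.eval x)]⟩

/-- A continuous function with compact support as an element of `polyBdd`. -/
def compactElem (g : C_c(ℝ, ℝ)) : polyBdd :=
  ⟨g.toContinuousMap, by
    obtain ⟨K, hK⟩ := g.hasCompactSupport.exists_bound_of_continuous g.continuous
    exact ⟨C K, fun x => by simpa using hK x⟩⟩

/-- The cutoff functions `max 0 (1 - x² / (n + 1)²)`. -/
def cutoff (n : ℕ) (x : ℝ) : ℝ := max 0 (1 - x ^ 2 / (n + 1) ^ 2)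

lemma cutoff_nonneg (n : ℕ) (x : ℝ) : 0 ≤ cutoff n x := le_max_left _ _

lemma cutoff_le_one (n : ℕ) (x : ℝ) : cutoff n x ≤ 1 :=
  max_le zero_le_one (by have : 0 ≤ x ^ 2 / ((n : ℝ) + 1) ^ 2 := by positivity
                         linarith)

lemma continuous_cutoff (n : ℕ) : Continuous (cutoff n) := by
  unfold cutoff; fun_prop

lemma one_sub_cutoff_le (n : ℕ) (x : ℝ) : 1 - cutoff n x ≤ x ^ 2 / (n + 1) ^ 2 := by
  have := le_max_right 0 (1 - x ^ 2 / ((n : ℝ) + 1) ^ 2)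
  unfold cutoff; linarith

lemma tendsto_inv_sq : Filter.Tendsto (fun n : ℕ => 1 / ((n : ℝ) + 1) ^ 2) .atTop (nhds 0) := by
  have := (tendsto_one_div_add_atTop_nhds_zero_nat (𝕜 := ℝ)).pow 2
  simpa using this

lemma tendsto_cutoff (x : ℝ) : Filter.Tendsto (fun n => cutoff n x) .atTop (nhds 1) := by
  have h : Filter.Tendsto (fun n : ℕ => 1 - x ^ 2 * (1 / ((n : ℝ) + 1) ^ 2)) .atTop (nhds 1) := by
    simpa using (tendsto_inv_sq.const_mul (x ^ 2)).const_sub 1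
  refine tendsto_of_tendsto_of_tendsto_of_le_of_le h tendsto_const_nhds (fun n => ?_)
    fun n => cutoff_le_one n x
  have := one_sub_cutoff_le n x
  simp only [mul_one_div]
  linarith

/-- The product of a continuous function with a cutoff function. -/
def cutMul (n : ℕ) (g : C(ℝ, ℝ)) : C_c(ℝ, ℝ) where
  toFun x := cutoff n x * g x
  continuous_toFun := (continuous_cutoff n).mul g.continuous
  hasCompactSupport' := by
    refine HasCompactSupport.intro (isCompact_Icc (a := -((n : ℝ) + 1)) (b := n + 1)) fun x hx => ?_
    have : 1 ≤ x ^ 2 / ((n : ℝ) + 1) ^ 2 := by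
      rw [one_le_div (by positivity), sq_le_sq, abs_of_pos (by positivity)]
      by_contra! h
      exact hx (abs_le.1 h.le)
    rw [cutoff, max_eq_left (by linarith), zero_mul]

lemma polyBdd_norm_le {μ : Measure ℝ} (hm : HasMoments μ) {L : polyBdd →ₗ[ℝ] ℝ}
    (hL : ∀ g, L g ≤ upperInt μ g) (g : polyBdd) {P : ℝ[X]} (h : ∀ x, |g.1 x| ≤ P.eval x) :
    |L g| ≤ ∫ x, P.eval x ∂μ := by
  refine abs_le.2 ⟨?_, (hL g).trans (upperInt_le hm fun x => (le_abs_self _).trans (h x))⟩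
  have := (hL (-g)).trans (upperInt_le hm fun x => (neg_le_abs (g.1 x)).trans (h x))
  rw [map_neg] at this
  linarith

lemma polyBdd_nonneg {μ : Measure ℝ} (hm : HasMoments μ) {L : polyBdd →ₗ[ℝ] ℝ}
    (hL : ∀ g, L g ≤ upperInt μ g) (g : polyBdd) (h : ∀ x, 0 ≤ g.1 x) : 0 ≤ L g := by
  have := (hL (-g)).trans (upperInt_le hm (P := 0) fun x => by simpa using h x)
  rw [map_neg] at this
  simpa using this

/-- A positive functional on `polyBdd` is the integral with respect to a measure: by the
Riesz–Markov–Kakutani theorem this holds on functions with compact support, and a function bounded by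
a polynomial is approximated by them, with an error controlled by a polynomial of larger degree. -/
lemma exists_measure_of_functional {μ : Measure ℝ} (hm : HasMoments μ) {L : polyBdd →ₗ[ℝ] ℝ}
    (hL : ∀ g, L g ≤ upperInt μ g) :
    ∃ σ : Measure ℝ, ∀ g : polyBdd, Integrable g.1 σ ∧ ∫ x, g.1 x ∂σ = L g := by
  let Λ : C_c(ℝ, ℝ) →ₚ[ℝ] ℝ := PositiveLinearMap.mk₀
    { toFun := fun g => L (compactElem g)
      map_add' := fun f g => by rw [← map_add]; rfl
      map_smul' := fun c g => by rw [RingHom.id_apply, ← map_smul]; rfl }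
    fun g hg => polyBdd_nonneg hm hL _ fun x => hg x
  refine ⟨RealRMK.rieszMeasure Λ, fun g => ?_⟩
  set σ := RealRMK.rieszMeasure Λ
  have hσ : ∀ n (g : polyBdd), ∫ x, cutoff n x * g.1 x ∂σ = L (compactElem (cutMul n g.1)) :=
    fun n g => RealRMK.integral_rieszMeasure Λ (cutMul n g.1)
  have hint : ∀ P : ℝ[X], (∀ x, 0 ≤ P.eval x) → Integrable (fun x => P.eval x) σ := by
    intro P hP
    refine ⟨P.continuous.aestronglyMeasurable, ?_⟩
    rw [hasFiniteIntegral_iff_ofReal (.of_forall hP)]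
    refine lt_of_le_of_lt ?_ (ENNReal.ofReal_lt_top (r := L (polyElem P)))
    have hlim : ∀ x, ENNReal.ofReal (P.eval x) =
        Filter.liminf (fun n => ENNReal.ofReal (cutoff n x * P.eval x)) .atTop := by
      intro x
      refine (Filter.Tendsto.liminf_eq ?_).symm
      refine (ENNReal.continuous_ofReal.tendsto _).comp ?_
      simpa using (tendsto_cutoff x).mul_const (P.eval x)
    simp only [hlim]
    refine (lintegral_liminf_le fun n => ?_).trans ?_
    · exact ((continuous_cutoff n).mul P.continuous).measurable.ennreal_ofReal
    · refine Filter.liminf_le_of_frequently_le' (.of_forall fun n => ?_)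
      rw [← ofReal_integral_eq_lintegral_ofReal]
      · refine ENNReal.ofReal_le_ofReal ?_
        rw [show (∫ x, cutoff n x * P.eval x ∂σ) = _ from hσ n (polyElem P), ← sub_nonneg, ← map_sub]
        refine polyBdd_nonneg hm hL _ fun x => sub_nonneg.2 ?_
        exact mul_le_of_le_one_left (hP x) (cutoff_le_one n x)
      · exact (cutMul n (polyElem P).1).continuous.integrable_of_hasCompactSupport
          (cutMul n (polyElem P).1).hasCompactSupport
      · exact .of_forall fun x => mul_nonneg (cutoff_nonneg n x) (hP x)
  obtain ⟨P, hP⟩ := g.2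
  have hgi : Integrable g.1 σ := (hint P fun x => (abs_nonneg _).trans (hP x)).mono'
    g.1.continuous.aestronglyMeasurable (.of_forall hP)
  refine ⟨hgi, ?_⟩
  have h1 : Filter.Tendsto (fun n => ∫ x, cutoff n x * g.1 x ∂σ) .atTop (nhds (∫ x, g.1 x ∂σ)) := by
    refine tendsto_integral_of_dominated_convergence (fun x => |g.1 x|) (fun n => ?_) hgi.abs
      (fun n => .of_forall fun x => ?_) (.of_forall fun x => ?_)
    · exact ((continuous_cutoff n).mul g.1.continuous).aestronglyMeasurable
    · rw [norm_mul, Real.norm_of_nonneg (cutoff_nonneg n x)]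
      exact mul_le_of_le_one_left (norm_nonneg _) (cutoff_le_one n x)
    · simpa using (tendsto_cutoff x).mul_const (g.1 x)
  have h2 : Filter.Tendsto (fun n => ∫ x, cutoff n x * g.1 x ∂σ) .atTop (nhds (L g)) := by
    rw [tendsto_iff_norm_sub_tendsto_zero]
    have hlim := tendsto_inv_sq.mul_const (∫ x, (X ^ 2 * P).eval x ∂μ)
    rw [zero_mul] at hlim
    refine squeeze_zero (fun _ => norm_nonneg _) (fun n => ?_) hlim
    rw [hσ, ← map_sub]
    have := polyBdd_norm_le hm hL (compactElem (cutMul n g.1) - g)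
      (P := C (1 / ((n : ℝ) + 1) ^ 2) * (X ^ 2 * P)) fun x => by
        change |cutoff n x * g.1 x - g.1 x| ≤ _
        have e : cutoff n x * g.1 x - g.1 x = -((1 - cutoff n x) * g.1 x) := by ring
        rw [e, abs_neg, abs_mul, abs_of_nonneg (sub_nonneg.2 (cutoff_le_one n x))]
        calc _ ≤ x ^ 2 / (n + 1) ^ 2 * P.eval x := by
              gcongr
              · exact one_sub_cutoff_le n x
              · exact hP x
          _ = _ := by simp; ring
    simpa only [eval_mul (p := C _), eval_C, integral_const_mul, Real.norm_eq_abs] using this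
  exact tendsto_nhds_unique h1 h2

lemma integral_sq_pos {μ : Measure ℝ} (hμ : μ ∈ MStar) {P : ℝ[X]} (hP : P ≠ 0) :
    0 < ∫ x, P.eval x * P.eval x ∂μ := by
  have hm : HasMoments μ := hμ.2
  have hint : Integrable (fun x => P.eval x * P.eval x) μ := by
    simpa using hm.integrable_eval (P * P)
  refine lt_of_le_of_ne (integral_nonneg fun x => mul_self_nonneg _) fun h => ?_
  have h0 := (integral_eq_zero_iff_of_nonneg (fun x => mul_self_nonneg _) hint).1 h.symm
  refine hμ.1 ((Polynomial.finite_setOfPred_isRoot hP).subset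
    (Measure.support_subset_of_isClosed ?_ ?_))
  · exact isClosed_eq P.continuous continuous_const
  · filter_upwards [h0] with x hx
    simpa using hx

lemma mem_MStar_of_integral_sq_pos {μ : Measure ℝ} (hm : HasMoments μ)
    (h : ∀ P : ℝ[X], P ≠ 0 → 0 < ∫ x, P.eval x * P.eval x ∂μ) : μ ∈ MStar := by
  refine ⟨fun hfin => ?_, hm⟩
  have := h (∏ a ∈ hfin.toFinset, (X - C a)) (Finset.prod_ne_zero_iff.2 fun a _ => X_sub_C_ne_zero a)
  refine this.ne' (integral_eq_zero_of_ae ?_)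
  filter_upwards [Measure.support_mem_ae (μ := μ)] with x hx
  rw [eval_prod, Finset.prod_eq_zero (hfin.mem_toFinset.2 hx) (by simp)]
  simp

lemma mem_MStar_of_moments {μ σ : Measure ℝ} (hμ : μ ∈ MStar) (hσ : HasMoments σ)
    (h : ∀ n, moment σ n = moment μ n) : σ ∈ MStar := by
  refine mem_MStar_of_integral_sq_pos hσ fun P hP => ?_
  have := moment_eq_integral_eval hμ.2 hσ h (P * P)
  simp only [eval_mul] at this
  rw [this]
  exact integral_sq_pos hμ hP

/-- A linear functional dominated by the upper integral with value `upperInt μ f` at `f` is the integral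
with respect to a solution of the moment problem, which is `μ` when `μ` is determinate. -/
lemma upperInt_eq_integral {μ : Measure ℝ} (hμ : μ ∈ Md) {f : polyBdd} (hf : f ≠ 0) :
    upperInt μ f = ∫ x, f.1 x ∂μ := by
  have hm : HasMoments μ := hμ.1.2
  obtain ⟨L, hLf, hL⟩ := exists_extension hm hf
  obtain ⟨σ, hσ⟩ := exists_measure_of_functional hm hL
  have hσm : HasMoments σ := fun n => by
    have := (hσ (polyElem (X ^ n))).1
    simpa [polyElem] using this
  have hmom : ∀ n, moment σ n = moment μ n := by
    intro n
    have hP : ∀ P : ℝ[X], L (polyElem P) ≤ ∫ x, P.eval x ∂μ := fun P =>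
      (hL _).trans (upperInt_le hm fun x => le_rfl)
    have h1 := hP (X ^ n)
    have h2 := hP (-X ^ n)
    rw [show polyElem (-X ^ n) = -polyElem (X ^ n) by ext x; simp [polyElem], map_neg] at h2
    have h3 := (hσ (polyElem (X ^ n))).2
    simp only [polyElem, ContinuousMap.coe_mk, eval_pow, eval_X, eval_neg, integral_neg] at h1 h2 h3
    simp only [moment]
    linarith
  have := hμ.2 σ ⟨mem_MStar_of_moments hμ.1 hσm hmom, hmom⟩
  rw [← hLf, ← (hσ f).2, this]

/-- The evaluation at `i` is unbounded for determinate measures. -/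
lemma not_boundedEval_of_mem_Md {μ : Measure ℝ} (hμ : μ ∈ Md) : ¬ BoundedEval μ := by
  have hm : HasMoments μ := hμ.1.2
  let f : polyBdd := ⟨⟨fun x => x / (1 + x ^ 2),
    continuous_id.div (by fun_prop) fun x => by positivity⟩, 1, fun x => by
      simp only [ContinuousMap.coe_mk, eval_one]
      rw [abs_div, abs_of_pos (show 0 < 1 + x ^ 2 by positivity), div_le_one (by positivity)]
      nlinarith [sq_abs x, sq_nonneg (|x| - 1)]⟩
  have hf : f ≠ 0 := by
    intro h
    have : f.1 1 = 0 := by rw [h]; rfl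
    norm_num [f] at this
  have hf' : -f ≠ 0 := neg_ne_zero.2 hf
  refine not_boundedEval_of_squeeze hm fun ε hε => ?_
  obtain ⟨P, hP, hP'⟩ := exists_lt_upperInt μ f (half_pos hε)
  obtain ⟨Q, hQ, hQ'⟩ := exists_lt_upperInt μ (-f) (half_pos hε)
  rw [upperInt_eq_integral hμ hf] at hP'
  rw [upperInt_eq_integral hμ hf'] at hQ'
  have e : ∫ x, (-f).1 x ∂μ = - ∫ x, f.1 x ∂μ := by rw [← integral_neg]; rfl
  rw [e] at hQ'
  refine ⟨P, -Q, fun x => ?_, hP, ?_⟩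
  · have := hQ x
    change -(x / (1 + x ^ 2)) ≤ _ at this
    rw [eval_neg]; linarith
  · simp only [eval_neg, integral_neg]
    linarith

/-- A measure is determinate if and only if the evaluation at `i` is unbounded. -/
lemma mem_Md_iff {μ : Measure ℝ} (hμ : μ ∈ MStar) : μ ∈ Md ↔ ¬ BoundedEval μ :=
  ⟨not_boundedEval_of_mem_Md, fun h => ⟨hμ, fun _ hσ =>
    eq_of_not_boundedEval hμ.2 hσ.1.2 hσ.2 h⟩⟩

lemma mem_Mi_iff_notMem_Md {μ : Measure ℝ} (hμ : μ ∈ MStar) : μ ∈ Mi ↔ μ ∉ Md := by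
  simp [Mi, Md, hμ]

lemma mem_Mi_iff {μ : Measure ℝ} (hμ : μ ∈ MStar) : μ ∈ Mi ↔ BoundedEval μ := by
  rw [mem_Mi_iff_notMem_Md hμ, mem_Md_iff hμ, not_not]

/-! ### Orthonormal polynomials -/

/-- The Gram–Schmidt process in `ℝ[X]`, with the inner product of `L²(μ)`, applied to the powers of
`X`; it leaves them monic, so that the normalized polynomials have positive leading coefficients. -/
lemma exists_isOrthonormalPolys {μ : Measure ℝ} (hμ : μ ∈ MStar) :
    ∃ p, IsOrthonormalPolys μ p := by
  have hm : HasMoments μ := hμ.2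
  have hi : ∀ P Q : ℝ[X], Integrable (fun x => P.eval x * Q.eval x) μ := fun P Q => by
    simpa using hm.integrable_eval (P * Q)
  let core : InnerProductSpace.Core ℝ ℝ[X] :=
    { inner := fun P Q => ∫ x, P.eval x * Q.eval x ∂μ
      conj_inner_symm := fun P Q => by simp [mul_comm]
      re_inner_nonneg := fun P => integral_nonneg fun x => mul_self_nonneg _
      add_left := fun P Q R => by
        simp only [eval_add, add_mul]
        exact integral_add (hi P R) (hi Q R)
      smul_left := fun P Q r => by
        simp only [eval_smul, smul_eq_mul, mul_assoc, integral_const_mul]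
        rfl
      definite := fun P hP => by
        by_contra h
        exact (integral_sq_pos hμ h).ne' hP }
  let _ : NormedAddCommGroup ℝ[X] := core.toNormedAddCommGroup
  let _ : InnerProductSpace ℝ ℝ[X] := InnerProductSpace.ofCore core.toCore
  let g : ℕ → ℝ[X] := InnerProductSpace.gramSchmidt ℝ fun n => X ^ n
  have hdeg : ∀ n, (g n).Monic ∧ (g n).degree = n := by
    intro n
    induction n using Nat.strong_induction_on with
    | _ n ih =>
    have hlt : (∑ i ∈ Finset.Iio n, (ℝ ∙ g i).starProjection (X ^ n : ℝ[X])).degree < n := by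
      refine mem_degreeLT.1 (Submodule.sum_mem _ fun i hi => mem_degreeLT.2 ?_)
      obtain ⟨c, hc⟩ := Submodule.mem_span_singleton.1
        (Submodule.starProjection_apply_mem (ℝ ∙ g i) (X ^ n : ℝ[X]))
      rw [← hc]
      have hi' := Finset.mem_Iio.1 hi
      exact (degree_smul_le _ _).trans_lt (by rw [(ih i hi').2]; exact_mod_cast hi')
    have e : g n = X ^ n - ∑ i ∈ Finset.Iio n, (ℝ ∙ g i).starProjection (X ^ n : ℝ[X]) :=
      InnerProductSpace.gramSchmidt_def ℝ _ n
    have hlt' : (∑ i ∈ Finset.Iio n, (ℝ ∙ g i).starProjection (X ^ n : ℝ[X])).degree <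
      (X ^ n : ℝ[X]).degree := by rwa [degree_X_pow]
    rw [e]
    exact ⟨(monic_X_pow n).sub_of_left hlt', by rw [degree_sub_eq_left_of_degree_lt hlt', degree_X_pow]⟩
  have hpos : ∀ n, 0 < ∫ x, (g n).eval x * (g n).eval x ∂μ := fun n =>
    integral_sq_pos hμ (hdeg n).1.ne_zero
  have hsq : ∀ n, 0 < √(∫ x, (g n).eval x * (g n).eval x ∂μ) := fun n => Real.sqrt_pos.2 (hpos n)
  refine ⟨fun n => C (√(∫ x, (g n).eval x * (g n).eval x ∂μ))⁻¹ * g n, fun n => ?_, fun n => ?_,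
    fun n m => ?_⟩
  · rw [natDegree_C_mul (inv_pos.2 (hsq n)).ne']
    exact natDegree_eq_of_degree_eq_some (hdeg n).2
  · rw [leadingCoeff_mul, leadingCoeff_C, (hdeg n).1.leadingCoeff, mul_one]
    exact inv_pos.2 (hsq n)
  · simp only [eval_mul, eval_C]
    have e : ∀ x a b : ℝ, a * (g n).eval x * (b * (g m).eval x) =
        a * b * ((g n).eval x * (g m).eval x) := fun x a b => by ring
    simp only [e, integral_const_mul]
    split_ifs with h
    · subst h
      rw [← mul_inv, Real.mul_self_sqrt (hpos n).le, inv_mul_cancel₀ (hpos n).ne']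
    · have : ∫ x, (g n).eval x * (g m).eval x ∂μ = 0 :=
        InnerProductSpace.gramSchmidt_orthogonal ℝ (fun n => (X ^ n : ℝ[X])) h
      rw [this, mul_zero]

/-- The quotient `(P(x) - P(z)) / (x - z)` as a polynomial in `x`. -/
def quotPoly (P : ℂ[X]) (z : ℂ) : ℂ[X] := P /ₘ (X - C z)

lemma eq_add_quotPoly (P : ℂ[X]) (z : ℂ) : P = C (P.eval z) + (X - C z) * quotPoly P z := by
  rw [quotPoly, ← modByMonic_X_sub_C_eq_C_eval, modByMonic_add_div]

lemma eval_eq_add_quotPoly (P : ℂ[X]) (z x : ℂ) :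
    P.eval x = P.eval z + (x - z) * (quotPoly P z).eval x := by
  conv_lhs => rw [eq_add_quotPoly P z]
  simp

lemma quotPoly_unique {P Q : ℂ[X]} {z c : ℂ} (h : P = C c + (X - C z) * Q) : quotPoly P z = Q := by
  have hc : P.eval z = c := by rw [h]; simp
  have := eq_add_quotPoly P z
  rw [hc] at this
  exact (mul_left_cancel₀ (X_sub_C_ne_zero z) (add_left_cancel (h.symm.trans this))).symm

lemma quotPoly_add (P Q : ℂ[X]) (z : ℂ) : quotPoly (P + Q) z = quotPoly P z + quotPoly Q z := by
  refine quotPoly_unique (c := P.eval z + Q.eval z) ?_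
  rw [C_add]
  linear_combination eq_add_quotPoly P z + eq_add_quotPoly Q z

lemma quotPoly_C (c z : ℂ) : quotPoly (C c) z = 0 := quotPoly_unique (c := c) (by simp)

lemma quotPoly_C_mul (c : ℂ) (P : ℂ[X]) (z : ℂ) : quotPoly (C c * P) z = C c * quotPoly P z := by
  refine quotPoly_unique (c := c * P.eval z) ?_
  rw [C_mul]
  linear_combination C c * eq_add_quotPoly P z

lemma quotPoly_sum (s : Finset ℕ) (f : ℕ → ℂ[X]) (z : ℂ) :
    quotPoly (∑ k ∈ s, f k) z = ∑ k ∈ s, quotPoly (f k) z := by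
  classical
  induction s using Finset.induction_on with
  | empty => simpa using quotPoly_C 0 z
  | insert a s ha ih => rw [Finset.sum_insert ha, Finset.sum_insert ha, quotPoly_add, ih]

lemma quotPoly_X_sub_C_mul (w : ℂ) (P : ℂ[X]) (z : ℂ) :
    quotPoly ((X - C w) * P) z = P + C (z - w) * quotPoly P z := by
  refine quotPoly_unique (c := (z - w) * P.eval z) ?_
  rw [C_mul, C_sub]
  linear_combination (C z - C w) * eq_add_quotPoly P z

lemma degree_quotPoly_lt {P : ℂ[X]} {n : ℕ} (h : P.degree < (n + 1 : ℕ)) (z : ℂ) :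
    (quotPoly P z).degree < n := by
  by_cases hP : quotPoly P z = 0
  · rw [hP, degree_zero]; exact WithBot.bot_lt_coe n
  have h1 := degree_divByMonic_lt P (X - C z) (by
    rintro rfl; exact hP (by simp [quotPoly])) (by simp)
  have h2 : P ≠ 0 := by rintro rfl; exact hP (by simp [quotPoly])
  change (quotPoly P z).degree < _ at h1
  rw [degree_eq_natDegree h2, degree_eq_natDegree hP] at h1
  rw [degree_eq_natDegree h2] at h
  rw [degree_eq_natDegree hP]
  norm_cast at *
  omega

/-- The polynomial `p` with complex coefficients. -/
def cpoly (p : ℝ[X]) : ℂ[X] := p.map Complex.ofRealHom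

lemma cval_eq (p : ℝ[X]) (z : ℂ) : cval p z = (cpoly p).eval z := by
  rw [cval, cpoly, eval_map, aeval_def]; rfl

lemma eval_cpoly_ofReal (p : ℝ[X]) (x : ℝ) : (cpoly p).eval (x : ℂ) = (p.eval x : ℝ) :=
  eval_map_ofReal p x

/-- The second kind polynomial is the integral of the quotient polynomial. -/
lemma secondKind_eq (μ : Measure ℝ) (p : ℝ[X]) (z : ℂ) :
    secondKind μ p z = ∫ x : ℝ, (quotPoly (cpoly p) z).eval (x : ℂ) ∂μ := by
  refine integral_congr_ae (.of_forall fun x => ?_)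
  have hf : cval p = fun w => (cpoly p).eval w := funext (cval_eq p)
  simp only [hf]
  by_cases h : z = (x : ℂ)
  · subst h
    rw [dslope_same, Polynomial.deriv]
    have := congrArg (fun P => (derivative P).eval (x : ℂ)) (eq_add_quotPoly (cpoly p) (x : ℂ))
    simpa using this
  · rw [dslope_of_ne _ h, slope_def_field, div_eq_iff (sub_ne_zero.2 h),
      eval_eq_add_quotPoly (cpoly p) z (x : ℂ)]
    ring

section Orthonormal

variable {μ : Measure ℝ} {p : ℕ → ℝ[X]}

lemma degree_cpoly (hp : IsOrthonormalPolys μ p) (n : ℕ) : (cpoly (p n)).degree = n := by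
  rw [cpoly, degree_map, degree_eq_natDegree, hp.natDegree_eq]
  intro h
  have := hp.leadingCoeff_pos n
  simp [h] at this

lemma integral_cpoly_mul (hp : IsOrthonormalPolys μ p) (n m : ℕ) :
    ∫ x : ℝ, (cpoly (p n)).eval (x : ℂ) * (cpoly (p m)).eval (x : ℂ) ∂μ = if n = m then 1 else 0 := by
  simp only [eval_cpoly_ofReal, ← Complex.ofReal_mul]
  rw [integral_complex_ofReal, hp.integral_mul]
  split_ifs <;> simp

lemma exists_eq_sum_cpoly (hp : IsOrthonormalPolys μ p) (n : ℕ) : ∀ P : ℂ[X], P.degree < n →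
    ∃ c : ℕ → ℂ, P = ∑ k ∈ Finset.range n, C (c k) * cpoly (p k) := by
  induction n with
  | zero => exact fun P hP => ⟨0, by simpa using hP⟩
  | succ n ih =>
    intro P hP
    have hl : (cpoly (p n)).coeff n ≠ 0 := by
      have := coeff_ne_zero_of_eq_degree (degree_cpoly hp n)
      exact this
    set a := P.coeff n / (cpoly (p n)).coeff n with ha
    obtain ⟨c, hc⟩ := ih (P - C a * cpoly (p n)) (by
      rw [degree_lt_iff_coeff_zero]
      intro m hm
      rw [coeff_sub, coeff_C_mul]
      rcases hm.lt_or_eq with hlt | rfl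
      · have h1 := (degree_lt_iff_coeff_zero P (n + 1)).1 hP m hlt
        have h2 : (cpoly (p n)).coeff m = 0 := coeff_eq_zero_of_degree_lt (by
          rw [degree_cpoly hp]; exact_mod_cast hlt)
        rw [h1, h2]; simp
      · rw [ha, div_mul_cancel₀ _ hl, sub_self])
    refine ⟨fun k => if k = n then a else c k, ?_⟩
    rw [Finset.sum_range_succ]
    simp only [if_true]
    have : ∑ k ∈ Finset.range n, C (if k = n then a else c k) * cpoly (p k) =
        ∑ k ∈ Finset.range n, C (c k) * cpoly (p k) :=
      Finset.sum_congr rfl fun k hk => by rw [if_neg (Finset.mem_range.1 hk).ne]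
    rw [this, ← hc]
    ring

/-- A linear functional on polynomials is determined by its values at the orthonormal polynomials. -/
lemma ext_cpoly (hp : IsOrthonormalPolys μ p) {L M : ℂ[X] →ₗ[ℂ] ℂ}
    (h : ∀ n, L (cpoly (p n)) = M (cpoly (p n))) (P : ℂ[X]) : L P = M P := by
  obtain ⟨c, hc⟩ := exists_eq_sum_cpoly hp (P.natDegree + 1) P
    (degree_le_natDegree.trans_lt (by exact_mod_cast Nat.lt_succ_self _))
  rw [hc, map_sum, map_sum]
  refine Finset.sum_congr rfl fun k _ => ?_
  rw [← smul_eq_C_mul, map_smul, map_smul, h]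

/-- The functional `P ↦ ∫ f P dμ` on polynomials. -/
def pairing (hm : HasMoments μ) {f : ℝ → ℂ} (hf : MemLp f 2 μ) : ℂ[X] →ₗ[ℂ] ℂ where
  toFun P := ∫ x, f x * P.eval (x : ℂ) ∂μ
  map_add' P Q := by
    simp only [eval_add, mul_add]
    exact integral_add (integrable_fun_mul hf (hm.memLp P)) (integrable_fun_mul hf (hm.memLp Q))
  map_smul' c P := by
    simp only [eval_smul, smul_eq_mul, RingHom.id_apply, ← integral_const_mul]
    congr 1; ext x; ring

lemma pairing_apply (hm : HasMoments μ) {f : ℝ → ℂ} (hf : MemLp f 2 μ) (P : ℂ[X]) :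
    pairing hm hf P = ∫ x, f x * P.eval (x : ℂ) ∂μ := rfl

lemma eq_sum_integral (hm : HasMoments μ) (hp : IsOrthonormalPolys μ p) {n : ℕ} {P : ℂ[X]}
    (hP : P.degree < n) : P = ∑ k ∈ Finset.range n,
      C (∫ x, (cpoly (p k)).eval (x : ℂ) * P.eval (x : ℂ) ∂μ) * cpoly (p k) := by
  obtain ⟨c, hc⟩ := exists_eq_sum_cpoly hp n P hP
  conv_lhs => rw [hc]
  refine Finset.sum_congr rfl fun k hk => ?_
  congr 2
  rw [← pairing_apply hm (hm.memLp (cpoly (p k))), hc, map_sum]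
  simp only [← smul_eq_C_mul, map_smul, pairing_apply, integral_cpoly_mul hp, smul_eq_mul, mul_ite,
    mul_one, mul_zero]
  rw [Finset.sum_ite_eq, if_pos hk]

lemma integral_mul_eq_zero_of_degree_lt (hm : HasMoments μ) (hp : IsOrthonormalPolys μ p) {n : ℕ}
    {P : ℂ[X]} (hP : P.degree < n) : ∫ x, (cpoly (p n)).eval (x : ℂ) * P.eval (x : ℂ) ∂μ = 0 := by
  rw [← pairing_apply hm (hm.memLp (cpoly (p n))), eq_sum_integral hm hp hP, map_sum]
  refine Finset.sum_eq_zero fun k hk => ?_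
  rw [← smul_eq_C_mul, map_smul, pairing_apply, integral_cpoly_mul hp,
    if_neg (Finset.mem_range.1 hk).ne', smul_zero]

/-- The Fourier coefficients of `1 / (x - z)`. -/
def resCoeff (μ : Measure ℝ) (p : ℕ → ℝ[X]) (z : ℂ) (n : ℕ) : ℂ :=
  ∫ x : ℝ, (cpoly (p n)).eval (x : ℂ) * (1 / ((x : ℂ) - z)) ∂μ

lemma resCoeff_eq (hm : HasMoments μ) {z : ℂ} (hz : z.im ≠ 0) (n : ℕ) :
    resCoeff μ p z n = secondKind μ (p n) z + stieltjesTransform μ z * cval (p n) z := by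
  have := hm.isFiniteMeasure
  have hi : Integrable (fun x : ℝ => 1 / ((x : ℂ) - z)) μ :=
    (memLp_resolvent hz).integrable (by norm_num)
  rw [secondKind_eq, cval_eq, stieltjesTransform, ← integral_mul_const,
    ← integral_add (hm.integrable_ceval _) (hi.mul_const _)]
  refine integral_congr_ae (.of_forall fun x => ?_)
  have h0 := ofReal_sub_ne_zero hz x
  simp only
  rw [eval_eq_add_quotPoly (cpoly (p n)) z (x : ℂ)]
  field_simp
  ring

/-- The coefficients in the expansion of `(p_n(x) - p_n(z)) / (x - z)` with respect to `p_k`, `k < n`. -/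
lemma integral_quotPoly_mul (hm : HasMoments μ) (hp : IsOrthonormalPolys μ p) {z : ℂ} (hz : z.im ≠ 0)
    {k n : ℕ} (hkn : k < n) :
    ∫ x : ℝ, (cpoly (p k)).eval (x : ℂ) * (quotPoly (cpoly (p n)) z).eval (x : ℂ) ∂μ =
      cval (p k) z * resCoeff μ p z n - cval (p n) z * resCoeff μ p z k := by
  have := hm.isFiniteMeasure
  have hR := memLp_resolvent (μ := μ) hz
  have hdeg : (quotPoly (cpoly (p k)) z).degree < n :=
    (degree_quotPoly_lt (n := k) (by rw [degree_cpoly hp]; exact_mod_cast Nat.lt_succ_self k) z).trans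
      (by exact_mod_cast hkn)
  have h0 := integral_mul_eq_zero_of_degree_lt hm hp hdeg
  rw [← sub_zero (integral _ _), ← h0, resCoeff, resCoeff, ← integral_const_mul,
    ← integral_const_mul, ← integral_sub ((integrable_fun_mul (hm.memLp _) hR).const_mul _)
      ((integrable_fun_mul (hm.memLp _) hR).const_mul _),
    ← integral_sub (integrable_fun_mul (hm.memLp _) (hm.memLp _))
      (integrable_fun_mul (hm.memLp _) (hm.memLp _))]
  refine integral_congr_ae (.of_forall fun x => ?_)
  have hx := ofReal_sub_ne_zero hz x
  simp only [cval_eq]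
  have e1 := eval_eq_add_quotPoly (cpoly (p n)) z (x : ℂ)
  have e2 := eval_eq_add_quotPoly (cpoly (p k)) z (x : ℂ)
  field_simp
  rw [e1, e2]
  ring

end Orthonormal

/-! ### Square summability -/

lemma norm_sq_add_le (a b : ℂ) : ‖a + b‖ ^ 2 ≤ 2 * ‖a‖ ^ 2 + 2 * ‖b‖ ^ 2 := by
  have := norm_add_le a b
  nlinarith [sq_nonneg (‖a‖ - ‖b‖), norm_nonneg (a + b)]

lemma norm_sq_sub_le (a b : ℂ) : ‖a - b‖ ^ 2 ≤ 2 * ‖a‖ ^ 2 + 2 * ‖b‖ ^ 2 := by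
  simpa [sub_eq_add_neg] using norm_sq_add_le a (-b)

/-- A discrete Gronwall inequality for a triangular system with square summable coefficients. -/
lemma summable_norm_sq_of_triangular {y b : ℕ → ℂ} {a : ℕ → ℕ → ℂ} {α : ℕ → ℝ} {w : ℂ}
    (hy : ∀ n, y n = b n + w * ∑ k ∈ Finset.range n, a n k * y k)
    (hb : Summable fun n => ‖b n‖ ^ 2) (hα : Summable α)
    (ha : ∀ n, ∑ k ∈ Finset.range n, ‖a n k‖ ^ 2 ≤ α n) : Summable fun n => ‖y n‖ ^ 2 := by
  set S : ℕ → ℝ := fun n => ∑ k ∈ Finset.range n, ‖y k‖ ^ 2 with hS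
  have hα0 : ∀ n, 0 ≤ α n := fun n => (Finset.sum_nonneg fun _ _ => by positivity).trans (ha n)
  have hS0 : ∀ n, 0 ≤ S n := fun n => Finset.sum_nonneg fun _ _ => by positivity
  set c : ℕ → ℝ := fun n => 2 * ‖b n‖ ^ 2 + 2 * ‖w‖ ^ 2 * α n with hc
  have hc0 : ∀ n, 0 ≤ c n := fun n => by have := hα0 n; positivity
  have hcs : Summable c := (hb.mul_left 2).add (hα.mul_left _)
  have hstep : ∀ n, S (n + 1) + 1 ≤ (S n + 1) * (1 + c n) := by
    intro n
    have h1 : ‖y n‖ ^ 2 ≤ 2 * ‖b n‖ ^ 2 + 2 * (‖w‖ ^ 2 * (α n * S n)) := by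
      rw [hy n]
      refine (norm_sq_add_le _ _).trans ?_
      rw [norm_mul, mul_pow]
      gcongr
      calc _ ≤ (∑ k ∈ Finset.range n, ‖a n k‖ * ‖y k‖) ^ 2 := by
            gcongr
            exact (norm_sum_le _ _).trans (by simp only [norm_mul]; exact le_rfl)
        _ ≤ (∑ k ∈ Finset.range n, ‖a n k‖ ^ 2) * ∑ k ∈ Finset.range n, ‖y k‖ ^ 2 :=
            Finset.sum_mul_sq_le_sq_mul_sq _ _ _
        _ ≤ _ := mul_le_mul_of_nonneg_right (ha n) (hS0 n)
    have h2 : S (n + 1) = S n + ‖y n‖ ^ 2 := Finset.sum_range_succ _ _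
    have h3 := mul_nonneg (hS0 n) (show 0 ≤ 2 * ‖b n‖ ^ 2 by positivity)
    have h4 : 0 ≤ 2 * ‖w‖ ^ 2 * α n := by have := hα0 n; positivity
    simp only [hc]
    nlinarith
  have hexp : ∀ n, S n + 1 ≤ Real.exp (∑ k ∈ Finset.range n, c k) := by
    intro n
    induction n with
    | zero => simp [hS]
    | succ n ih =>
      rw [Finset.sum_range_succ, Real.exp_add]
      refine (hstep n).trans (mul_le_mul ih ?_ (by have := hc0 n; positivity) (Real.exp_pos _).le)
      rw [add_comm]; exact Real.add_one_le_exp _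
  refine summable_of_sum_range_le (c := Real.exp (∑' k, c k)) (fun _ => by positivity) fun n => ?_
  have h1 := hexp n
  have h2 : Real.exp (∑ k ∈ Finset.range n, c k) ≤ Real.exp (∑' k, c k) :=
    Real.exp_le_exp.2 (hcs.sum_le_tsum _ fun k _ => hc0 k)
  change S n ≤ _
  linarith

section Orthonormal

variable {μ : Measure ℝ} {p : ℕ → ℝ[X]}

/-- The map from polynomials to `L²(μ)`. -/
def toLpPoly (hm : HasMoments μ) : ℂ[X] →ₗ[ℂ] Lp ℂ 2 μ where
  toFun P := (hm.memLp P).toLp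
  map_add' P Q := by
    rw [← MemLp.toLp_add, MemLp.toLp_eq_toLp_iff]
    exact .of_forall fun x => by simp
  map_smul' c P := by
    rw [RingHom.id_apply, ← MemLp.toLp_const_smul, MemLp.toLp_eq_toLp_iff]
    exact .of_forall fun x => by simp

lemma toLpPoly_apply (hm : HasMoments μ) (P : ℂ[X]) : toLpPoly hm P = (hm.memLp P).toLp := rfl

/-- The orthonormal polynomials as elements of `L²(μ)`. -/
def polyLp (hm : HasMoments μ) (p : ℕ → ℝ[X]) (n : ℕ) : Lp ℂ 2 μ := toLpPoly hm (cpoly (p n))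

lemma inner_toLp {f g : ℝ → ℂ} (hf : MemLp f 2 μ) (hg : MemLp g 2 μ) :
    inner ℂ hf.toLp hg.toLp = ∫ x, conj (f x) * g x ∂μ := by
  rw [L2.inner_def]
  refine integral_congr_ae ?_
  filter_upwards [hf.coeFn_toLp, hg.coeFn_toLp] with x h1 h2
  rw [h1, h2, RCLike.inner_apply, mul_comm]

lemma norm_sq_toLp {f : ℝ → ℂ} (hf : MemLp f 2 μ) : ‖hf.toLp‖ ^ 2 = l2sq μ f := by
  rw [← Complex.ofReal_inj, Complex.ofReal_pow]
  have := inner_self_eq_norm_sq_to_K (𝕜 := ℂ) hf.toLp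
  rw [inner_toLp] at this
  refine this.symm.trans ?_
  rw [l2sq, ← integral_complex_ofReal]
  refine integral_congr_ae (.of_forall fun x => ?_)
  simp only
  rw [mul_comm, Complex.mul_conj, Complex.normSq_eq_norm_sq]

lemma inner_polyLp_toLp (hm : HasMoments μ) {f : ℝ → ℂ} (hf : MemLp f 2 μ) (n : ℕ) :
    inner ℂ (polyLp hm p n) hf.toLp = ∫ x, (cpoly (p n)).eval (x : ℂ) * f x ∂μ := by
  rw [polyLp, toLpPoly_apply, inner_toLp]
  simp only [eval_cpoly_ofReal, Complex.conj_ofReal]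

lemma orthonormal_polyLp (hm : HasMoments μ) (hp : IsOrthonormalPolys μ p) :
    Orthonormal ℂ (polyLp hm p) := by
  rw [orthonormal_iff_ite]
  intro i j
  rw [← integral_cpoly_mul hp i j, ← inner_polyLp_toLp hm (hm.memLp _)]
  rfl

lemma summable_resCoeff (hm : HasMoments μ) (hp : IsOrthonormalPolys μ p) {z : ℂ} (hz : z.im ≠ 0) :
    Summable fun n => ‖resCoeff μ p z n‖ ^ 2 := by
  have := hm.isFiniteMeasure
  have h := (orthonormal_polyLp hm hp).inner_products_summable (memLp_resolvent (μ := μ) hz).toLp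
  simpa only [inner_polyLp_toLp, resCoeff] using h

lemma toLpPoly_sum (hm : HasMoments μ) (c : ℕ → ℂ) (s : Finset ℕ) :
    toLpPoly hm (∑ k ∈ s, C (c k) * cpoly (p k)) = ∑ k ∈ s, c k • polyLp hm p k := by
  simp only [map_sum, ← smul_eq_C_mul, map_smul, polyLp]

lemma l2sq_sum_cpoly (hm : HasMoments μ) (hp : IsOrthonormalPolys μ p) (c : ℕ → ℂ) (s : Finset ℕ) :
    l2sq μ (fun x => (∑ k ∈ s, C (c k) * cpoly (p k)).eval (x : ℂ)) = ∑ k ∈ s, ‖c k‖ ^ 2 := by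
  have h := (orthonormal_polyLp hm hp).inner_sum c c s
  rw [← toLpPoly_sum, inner_self_eq_norm_sq_to_K, toLpPoly_apply] at h
  rw [← norm_sq_toLp (hm.memLp _), ← Complex.ofReal_inj]
  push_cast
  refine h.trans (Finset.sum_congr rfl fun k _ => ?_)
  rw [mul_comm, Complex.mul_conj, Complex.normSq_eq_norm_sq]
  push_cast
  rfl

/-- Both the value at `i` and the squared norm of the polynomial `∑ conj (p_k(i)) p_k` are `∑ |p_k(i)|²`,
so the bound on the evaluation bounds these sums. -/
lemma summable_cval_I (hm : HasMoments μ) (hp : IsOrthonormalPolys μ p) (hE : BoundedEval μ) :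
    Summable fun n => ‖cval (p n) I‖ ^ 2 := by
  obtain ⟨K, hK⟩ := hE
  refine summable_of_sum_range_le (c := K) (fun _ => by positivity) fun n => ?_
  have := hK (∑ k ∈ Finset.range n, C (conj (cval (p k) I)) * cpoly (p k))
  rw [l2sq_sum_cpoly hm hp, eval_finsetSum] at this
  simp only [eval_mul, eval_C, ← cval_eq, RCLike.norm_conj] at this
  set T := ∑ k ∈ Finset.range n, ‖cval (p k) I‖ ^ 2 with hT
  have hT0 : 0 ≤ T := Finset.sum_nonneg fun _ _ => by positivity
  have e : ∑ k ∈ Finset.range n, conj (cval (p k) I) * cval (p k) I = (T : ℂ) := by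
    rw [hT]
    push_cast
    refine Finset.sum_congr rfl fun k _ => ?_
    rw [mul_comm, Complex.mul_conj, Complex.normSq_eq_norm_sq]
    push_cast; rfl
  rw [e, Complex.norm_real, Real.norm_of_nonneg hT0] at this
  rcases hT0.eq_or_lt with h | h
  · have h2 := hK 1
    have h3 := l2sq_nonneg μ fun x => (1 : ℂ[X]).eval (x : ℂ)
    rw [← h]
    simp only [eval_one, norm_one, one_pow] at h2 h3
    by_contra! hneg
    nlinarith
  · nlinarith

/-- The expansion of `(p_n(x) - p_n(i)) / (x - i)` in the orthonormal polynomials. -/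
lemma cpoly_eq_add (hm : HasMoments μ) (hp : IsOrthonormalPolys μ p) (n : ℕ) :
    cpoly (p n) = C (cval (p n) I) + (X - C I) * ∑ k ∈ Finset.range n,
      C (cval (p k) I * resCoeff μ p I n - cval (p n) I * resCoeff μ p I k) * cpoly (p k) := by
  conv_lhs => rw [eq_add_quotPoly (cpoly (p n)) I, eq_sum_integral hm hp (n := n)
    (degree_quotPoly_lt (by rw [degree_cpoly hp]; exact_mod_cast Nat.lt_succ_self n) I)]
  rw [← cval_eq]
  congr 2
  refine Finset.sum_congr rfl fun k hk => ?_
  rw [integral_quotPoly_mul hm hp (by simp) (Finset.mem_range.1 hk)]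

/-- If the evaluation at `i` is bounded, then `∑ |p_n(z)|²` and `∑ |q_n(z)|²` are finite for every
`z`: the values at `z` satisfy a triangular system with the values at `i` as data. -/
lemma summable_cval_secondKind (hm : HasMoments μ) (hp : IsOrthonormalPolys μ p)
    (hE : BoundedEval μ) (z : ℂ) : (Summable fun n => ‖cval (p n) z‖ ^ 2) ∧
      Summable fun n => ‖secondKind μ (p n) z‖ ^ 2 := by
  have hI : I.im ≠ 0 := by simp
  have hpI := summable_cval_I hm hp hE
  have huI := summable_resCoeff hm hp hI
  have hqI : Summable fun n => ‖secondKind μ (p n) I‖ ^ 2 := by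
    refine Summable.of_nonneg_of_le (fun _ => by positivity) (fun n => ?_)
      ((huI.mul_left 2).add (hpI.mul_left (2 * ‖stieltjesTransform μ I‖ ^ 2)))
    have e : secondKind μ (p n) I = resCoeff μ p I n - stieltjesTransform μ I * cval (p n) I := by
      rw [resCoeff_eq hm hI]; ring
    rw [e]
    refine (norm_sq_sub_le _ _).trans_eq ?_
    rw [norm_mul]; ring
  have hα : Summable fun n => 2 * (‖resCoeff μ p I n‖ ^ 2 * ∑' k, ‖cval (p k) I‖ ^ 2) +
      2 * (‖cval (p n) I‖ ^ 2 * ∑' k, ‖resCoeff μ p I k‖ ^ 2) :=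
    ((huI.mul_right _).mul_left 2).add ((hpI.mul_right _).mul_left 2)
  have ha : ∀ n, ∑ k ∈ Finset.range n,
      ‖cval (p k) I * resCoeff μ p I n - cval (p n) I * resCoeff μ p I k‖ ^ 2 ≤
      2 * (‖resCoeff μ p I n‖ ^ 2 * ∑' k, ‖cval (p k) I‖ ^ 2) +
      2 * (‖cval (p n) I‖ ^ 2 * ∑' k, ‖resCoeff μ p I k‖ ^ 2) := by
    intro n
    calc _ ≤ ∑ k ∈ Finset.range n, (2 * (‖resCoeff μ p I n‖ ^ 2 * ‖cval (p k) I‖ ^ 2) +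
            2 * (‖cval (p n) I‖ ^ 2 * ‖resCoeff μ p I k‖ ^ 2)) := by
          refine Finset.sum_le_sum fun k _ => (norm_sq_sub_le _ _).trans_eq ?_
          rw [norm_mul, norm_mul]; ring
      _ ≤ _ := by
          rw [Finset.sum_add_distrib, ← Finset.mul_sum, ← Finset.mul_sum, ← Finset.mul_sum,
            ← Finset.mul_sum]
          gcongr
          · exact hpI.sum_le_tsum _ fun _ _ => by positivity
          · exact huI.sum_le_tsum _ fun _ _ => by positivity
  refine ⟨summable_norm_sq_of_triangular (w := z - I) (fun n => ?_) hpI hα ha,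
    summable_norm_sq_of_triangular (w := z - I) (fun n => ?_) hqI hα ha⟩
  · conv_lhs => rw [cval_eq, cpoly_eq_add hm hp n]
    simp [eval_finsetSum, cval_eq]
  · have hR := cpoly_eq_add hm hp n
    have hq : quotPoly (cpoly (p n)) I = ∑ k ∈ Finset.range n,
      C (cval (p k) I * resCoeff μ p I n - cval (p n) I * resCoeff μ p I k) * cpoly (p k) :=
      quotPoly_unique hR
    have e : quotPoly (cpoly (p n)) z = quotPoly (cpoly (p n)) I + C (z - I) *
        ∑ k ∈ Finset.range n, C (cval (p k) I * resCoeff μ p I n - cval (p n) I * resCoeff μ p I k) *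
          quotPoly (cpoly (p k)) z := by
      conv_lhs => rw [hR, quotPoly_add, quotPoly_C, zero_add, quotPoly_X_sub_C_mul, quotPoly_sum]
      simp only [quotPoly_C_mul, hq]
    simp only [secondKind_eq]
    rw [e]
    simp only [eval_add, eval_mul, eval_C, eval_finsetSum]
    rw [integral_add (hm.integrable_ceval _), integral_const_mul, integral_finsetSum]
    · simp only [integral_const_mul]
    · exact fun k _ => (hm.integrable_ceval _).const_mul _
    · exact (integrable_finsetSum _ fun k _ => (hm.integrable_ceval _).const_mul _).const_mul _

/-- The Riesz–Fischer theorem for the orthonormal polynomials: a square summable sequence `c` is the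
sequence of coefficients of a limit of polynomials, and Parseval's formula holds. -/
lemma exists_series (hm : HasMoments μ) (hp : IsOrthonormalPolys μ p) {c : ℕ → ℂ}
    (hc : Summable fun n => ‖c n‖ ^ 2) : ∃ v : ℝ → ℂ, PolyApprox μ v ∧ ∀ f : ℝ → ℂ, MemLp f 2 μ →
      HasSum (fun n => c n * ∫ x, (cpoly (p n)).eval (x : ℂ) * f x ∂μ) (∫ x, v x * f x ∂μ) := by
  have ho := orthonormal_polyLp hm hp
  have hs : Summable fun n => conj (c n) • polyLp hm p n := by
    have h := ho.orthogonalFamily.summable_iff_norm_sq_summable (fun n => conj (c n))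
    simp only [RCLike.norm_conj] at h
    simpa [LinearIsometry.toSpanSingleton_apply] using h.2 hc
  obtain ⟨V, hV⟩ := hs
  have hVm : MemLp V 2 μ := Lp.memLp V
  have hVe : hVm.toLp = V := Lp.toLp_coeFn V hVm
  have hVa : PolyApprox μ V := by
    refine ⟨hVm, fun ε hε => ?_⟩
    have := hV.eventually (Metric.ball_mem_nhds V (Real.sqrt_pos.2 hε))
    obtain ⟨s, hs⟩ := this.exists
    refine ⟨∑ k ∈ s, C (conj (c k)) * cpoly (p k), ?_⟩
    simp only at hs
    rw [dist_comm, dist_eq_norm, ← toLpPoly_sum, toLpPoly_apply] at hs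
    have e : V - (hm.memLp (∑ k ∈ s, C (conj (c k)) * cpoly (p k))).toLp =
        (memLp_fun_sub hVm (hm.memLp (∑ k ∈ s, C (conj (c k)) * cpoly (p k)))).toLp := by
      conv_lhs => rw [← hVe]
      exact (MemLp.toLp_sub hVm (hm.memLp _)).symm
    rw [e] at hs
    rw [← norm_sq_toLp (memLp_fun_sub hVm (hm.memLp _))]
    exact (Real.lt_sqrt (norm_nonneg _)).1 hs
  refine ⟨fun x => conj (V x), hVa.conj, fun f hf => ?_⟩
  have h1 := (innerSL ℂ (E := Lp ℂ 2 μ) hf.toLp).hasSum hV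
  have h2 := Complex.hasSum_conj'.2 h1
  have e : ∀ W : Lp ℂ 2 μ, conj (innerSL ℂ hf.toLp W) = inner ℂ W hf.toLp := fun W =>
    inner_conj_symm W hf.toLp
  simp only [map_smul, smul_eq_mul, map_mul, e, Complex.conj_conj, inner_polyLp_toLp] at h2
  rw [← hVe, inner_toLp] at h2
  convert! h2 using 1

end Orthonormal

/-! ### The Nevanlinna functions as integrals -/

section Nevanlinna

variable {μ : Measure ℝ} {p : ℕ → ℝ[X]}

lemma conjPoly_cpoly (p : ℝ[X]) : conjPoly (cpoly p) = cpoly p := by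
  rw [conjPoly, cpoly, Polynomial.map_map]
  congr 1
  ext x
  simp

lemma conj_cval (p : ℝ[X]) (z : ℂ) : conj (cval p z) = cval p (conj z) := by
  rw [cval_eq, cval_eq]
  conv_rhs => rw [← conjPoly_cpoly, eval_conjPoly, Complex.conj_conj]

lemma conj_secondKind (p : ℝ[X]) (z : ℂ) : conj (secondKind μ p z) = secondKind μ p (conj z) := by
  have hq : quotPoly (cpoly p) (conj z) = conjPoly (quotPoly (cpoly p) z) := by
    refine quotPoly_unique (c := conj ((cpoly p).eval z)) ?_
    conv_lhs => rw [← conjPoly_cpoly, eq_add_quotPoly (cpoly p) z]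
    simp [conjPoly]
  rw [secondKind_eq, secondKind_eq, hq, ← integral_conj]
  simp only [eval_conjPoly_ofReal]

/-- For real coefficients the sum of the series may be chosen real. -/
lemma exists_real_series (hm : HasMoments μ) (hp : IsOrthonormalPolys μ p) {c : ℕ → ℂ}
    (hc : Summable fun n => ‖c n‖ ^ 2) (hr : ∀ n, conj (c n) = c n) :
    ∃ v : ℝ → ℝ, PolyApprox μ (fun x => (v x : ℂ)) ∧ ∀ f : ℝ → ℂ, MemLp f 2 μ →
      HasSum (fun n => c n * ∫ x, (cpoly (p n)).eval (x : ℂ) * f x ∂μ) (∫ x, (v x : ℂ) * f x ∂μ) := by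
  obtain ⟨v, hv, hs⟩ := exists_series hm hp hc
  have e : ∀ x, ((v x).re : ℂ) = (1 / 2 : ℂ) * v x + (1 / 2 : ℂ) * conj (v x) := fun x => by
    rw [Complex.re_eq_add_conj]; ring
  refine ⟨fun x => (v x).re, ?_, fun f hf => ?_⟩
  · simp only [e]
    exact (hv.const_mul _).add hm (hv.conj.const_mul _)
  · have hfc : MemLp (fun x => conj (f x)) 2 μ := Complex.conjCLE.toContinuousLinearMap.comp_memLp' hf
    have h2 := Complex.hasSum_conj'.2 (hs _ hfc)
    simp only [map_mul, ← integral_conj, hr, Complex.conj_conj, eval_cpoly_ofReal,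
      Complex.conj_ofReal] at h2
    have h1 := hs f hf
    simp only [eval_cpoly_ofReal] at h1 ⊢
    have h3 := (h1.mul_left (1 / 2 : ℂ)).add (h2.mul_left (1 / 2 : ℂ))
    convert! h3 using 1
    · ext n; ring
    · simp only [e, add_mul, mul_assoc]
      rw [integral_add ((integrable_fun_mul hv.1 hf).const_mul _)
        ((integrable_fun_mul hv.conj.1 hf).const_mul _), integral_const_mul, integral_const_mul]

lemma integral_series_mul_cpoly (hm : HasMoments μ) (hp : IsOrthonormalPolys μ p) {c : ℕ → ℂ} {v : ℝ → ℂ}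
    (hs : ∀ f : ℝ → ℂ, MemLp f 2 μ →
      HasSum (fun n => c n * ∫ x, (cpoly (p n)).eval (x : ℂ) * f x ∂μ) (∫ x, v x * f x ∂μ)) (n : ℕ) :
    ∫ x, v x * (cpoly (p n)).eval (x : ℂ) ∂μ = c n := by
  have h := hs _ (hm.memLp (cpoly (p n)))
  simp only [integral_cpoly_mul hp, mul_ite, mul_one, mul_zero] at h
  have h2 := hasSum_ite_eq n (c n)
  refine h.unique ?_
  convert! h2 using 2 with m
  by_cases hmn : m = n
  · simp [hmn]
  · simp [hmn]

/-- The functional `P ↦ P(z)`. -/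
def evalLin (z : ℂ) : ℂ[X] →ₗ[ℂ] ℂ where
  toFun P := P.eval z
  map_add' _ _ := eval_add
  map_smul' _ _ := eval_smul _ _ _

/-- The functional `P ↦ ∫ (P(x) - P(z)) / (x - z) dμ(x)`. -/
def quotLin (hm : HasMoments μ) (z : ℂ) : ℂ[X] →ₗ[ℂ] ℂ where
  toFun P := ∫ x : ℝ, (quotPoly P z).eval (x : ℂ) ∂μ
  map_add' P Q := by
    simp only [quotPoly_add, eval_add]
    exact integral_add (hm.integrable_ceval _) (hm.integrable_ceval _)
  map_smul' c P := by
    simp only [smul_eq_C_mul, quotPoly_C_mul, eval_mul, eval_C, integral_const_mul, smul_eq_mul,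
      RingHom.id_apply]

/-- Real functions `κ = ∑ p_k(0) p_k` and `l = ∑ q_k(0) p_k`, through which the Nevanlinna functions
are expressed. They represent the functionals `P ↦ P(0)` and `P ↦ ∫ (P(x) - P(0)) / x dμ(x)`. -/
structure IsNevanlinnaPair (μ : Measure ℝ) (p : ℕ → ℝ[X]) (κ l : ℝ → ℝ) : Prop where
  approx_kappa : PolyApprox μ fun x => (κ x : ℂ)
  approx_l : PolyApprox μ fun x => (l x : ℂ)
  integral_kappa : ∀ P : ℂ[X], ∫ x, (κ x : ℂ) * P.eval (x : ℂ) ∂μ = P.eval 0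
  integral_l : ∀ P : ℂ[X],
    ∫ x, (l x : ℂ) * P.eval (x : ℂ) ∂μ = ∫ x : ℝ, (quotPoly P 0).eval (x : ℂ) ∂μ
  nevC_add : ∀ z : ℂ, z.im ≠ 0 → nevC μ p z + stieltjesTransform μ z * nevD p z =
    ∫ x, 1 / ((x : ℂ) - z) * (x * κ x) ∂μ
  nevA_add : ∀ z : ℂ, z.im ≠ 0 → nevA μ p z + stieltjesTransform μ z * nevB μ p z =
    ∫ x, 1 / ((x : ℂ) - z) * (x * l x - 1) ∂μ
  exists_kernel : ∀ z : ℂ, z.im ≠ 0 → ∃ k : ℝ → ℂ, PolyApprox μ k ∧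
    (∀ P : ℂ[X], ∫ x, k x * P.eval (x : ℂ) ∂μ = P.eval z) ∧
    nevD p z = z * ∫ x, (κ x : ℂ) * k x ∂μ ∧ nevB μ p z = -1 + z * ∫ x, (l x : ℂ) * k x ∂μ

lemma memLp_id (hm : HasMoments μ) : MemLp (fun x : ℝ => (x : ℂ)) 2 μ := by
  simpa using hm.memLp X

lemma summable_mul_of_sq {a b : ℕ → ℂ} (ha : Summable fun n => ‖a n‖ ^ 2)
    (hb : Summable fun n => ‖b n‖ ^ 2) : Summable fun n => a n * b n := by
  refine Summable.of_norm_bounded (ha.add hb) fun n => ?_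
  rw [norm_mul]
  nlinarith [sq_nonneg (‖a n‖ - ‖b n‖), sq_nonneg (‖a n‖ + ‖b n‖)]

/-- The functions are `κ = ∑ p_k(0) p_k` and `l = ∑ q_k(0) p_k`; the products with `1 / (x - z)` are
evaluated termwise, since its coefficients are `q_n(z) + F(z) p_n(z)`. -/
lemma exists_nevanlinnaPair (hm : HasMoments μ) (hp : IsOrthonormalPolys μ p) (hE : BoundedEval μ) :
    ∃ κ l : ℝ → ℝ, IsNevanlinnaPair μ p κ l := by
  have := hm.isFiniteMeasure
  have hs := fun z => (summable_cval_secondKind hm hp hE z)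
  obtain ⟨κ, hκ, hκs⟩ := exists_real_series hm hp (hs 0).1 fun n => by rw [conj_cval, map_zero]
  obtain ⟨l, hl, hls⟩ := exists_real_series hm hp (hs 0).2 fun n => by rw [conj_secondKind, map_zero]
  have hκP : ∀ P : ℂ[X], ∫ x, (κ x : ℂ) * P.eval (x : ℂ) ∂μ = P.eval 0 := fun P =>
    ext_cpoly hp (L := pairing hm hκ.1) (M := evalLin 0) (fun n => by
      rw [pairing_apply, integral_series_mul_cpoly hm hp hκs, cval_eq]; rfl) P
  have hlP : ∀ P : ℂ[X], ∫ x, (l x : ℂ) * P.eval (x : ℂ) ∂μ =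
      ∫ x : ℝ, (quotPoly P 0).eval (x : ℂ) ∂μ := fun P =>
    ext_cpoly hp (L := pairing hm hl.1) (M := quotLin hm 0) (fun n => by
      rw [pairing_apply, integral_series_mul_cpoly hm hp hls, secondKind_eq]; rfl) P
  have hr : ∀ z : ℂ, z.im ≠ 0 → ∀ n, ∫ x : ℝ, (cpoly (p n)).eval (x : ℂ) * (1 / ((x : ℂ) - z)) ∂μ =
      secondKind μ (p n) z + stieltjesTransform μ z * cval (p n) z := fun z hz n => resCoeff_eq hm hz n
  have hκ1 : ∫ x, (κ x : ℂ) ∂μ = 1 := by simpa using hκP 1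
  have hl1 : ∫ x, (l x : ℂ) ∂μ = 0 := by
    have := hlP (C 1)
    rw [quotPoly_C] at this
    simpa using this
  refine ⟨κ, l, hκ, hl, hκP, hlP, fun z hz => ?_, fun z hz => ?_, fun z hz => ?_⟩
  · have hR := memLp_resolvent (μ := μ) hz
    have h := hκs _ hR
    simp only [hr z hz] at h
    have h1 := summable_mul_of_sq (hs 0).1 (hs z).2
    have h2 := summable_mul_of_sq (hs 0).1 (hs z).1
    have h3 : (∑' k, cval (p k) 0 * secondKind μ (p k) z) +
        stieltjesTransform μ z * ∑' k, cval (p k) 0 * cval (p k) z =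
        ∫ x, (κ x : ℂ) * (1 / ((x : ℂ) - z)) ∂μ := by
      rw [← h.tsum_eq, ← tsum_mul_left, ← h1.tsum_add (h2.mul_left _)]
      exact tsum_congr fun k => by ring
    have e : ∀ x : ℝ, 1 / ((x : ℂ) - z) * (x * κ x) = κ x + z * (κ x * (1 / ((x : ℂ) - z))) := by
      intro x
      have := ofReal_sub_ne_zero hz x
      field_simp
      ring
    simp only [e]
    rw [integral_add (hκ.1.integrable (by norm_num)) ((integrable_fun_mul hκ.1 hR).const_mul _),
      integral_const_mul, ← h3, hκ1, nevC, nevD]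
    ring
  · have hR := memLp_resolvent (μ := μ) hz
    have h := hls _ hR
    simp only [hr z hz] at h
    have h1 := summable_mul_of_sq (hs 0).2 (hs z).2
    have h2 := summable_mul_of_sq (hs 0).2 (hs z).1
    have h3 : (∑' k, secondKind μ (p k) 0 * secondKind μ (p k) z) +
        stieltjesTransform μ z * ∑' k, secondKind μ (p k) 0 * cval (p k) z =
        ∫ x, (l x : ℂ) * (1 / ((x : ℂ) - z)) ∂μ := by
      rw [← h.tsum_eq, ← tsum_mul_left, ← h1.tsum_add (h2.mul_left _)]
      exact tsum_congr fun k => by ring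
    have e : ∀ x : ℝ, 1 / ((x : ℂ) - z) * (x * l x - 1) =
        l x + z * (l x * (1 / ((x : ℂ) - z))) - 1 / ((x : ℂ) - z) := by
      intro x
      have := ofReal_sub_ne_zero hz x
      field_simp
      ring
    simp only [e]
    have hli : Integrable (fun x => (l x : ℂ)) μ := hl.1.integrable (by norm_num)
    have hzi : Integrable (fun x => z * ((l x : ℂ) * (1 / ((x : ℂ) - z)))) μ :=
      (integrable_fun_mul hl.1 hR).const_mul _
    have hsum : Integrable (fun x => (l x : ℂ) + z * ((l x : ℂ) * (1 / ((x : ℂ) - z)))) μ := hli.add hzi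
    rw [integral_sub hsum (hR.integrable (by norm_num)), integral_add hli hzi,
      integral_const_mul, ← h3, hl1, nevA, nevB, ← stieltjesTransform]
    ring
  · obtain ⟨k, hk, hks⟩ := exists_series hm hp (hs z).1
    have hkc := integral_series_mul_cpoly hm hp hks
    refine ⟨k, hk, fun P => ext_cpoly hp (L := pairing hm hk.1) (M := evalLin z) (fun n => by
      rw [pairing_apply, hkc, cval_eq]; rfl) P, ?_, ?_⟩
    · have h := hκs k hk.1
      simp only [mul_comm (eval _ _), hkc] at h
      rw [nevD, h.tsum_eq]
    · have h := hls k hk.1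
      simp only [mul_comm (eval _ _), hkc] at h
      rw [nevB, h.tsum_eq]

end Nevanlinna

/-! ### Uniqueness of the Stieltjes transform -/

section Stieltjes

variable {μ : Measure ℝ}

lemma integrable_mul_bcf {g : ℝ → ℂ} (hg : Integrable g μ) (f : ℝ →ᵇ ℂ) :
    Integrable (fun x => g x * f x) μ :=
  hg.mul_bdd f.continuous.aestronglyMeasurable (.of_forall f.norm_coe_le_norm)

lemma integrable_mul_resolvent {g : ℝ → ℂ} (hg : Integrable g μ) {z : ℂ} (hz : z.im ≠ 0) :
    Integrable (fun x : ℝ => g x * (1 / ((x : ℂ) - z))) μ :=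
  integrable_mul_bcf hg (resolventBCF z hz)

/-- For `z ≠ w` this follows from partial fractions, and for `z = w` by continuity in `z`. -/
lemma integral_mul_resolvent_sq {g : ℝ → ℂ} (hg : Integrable g μ) {f : ℝ →ᵇ ℂ}
    (h : ∀ z : ℂ, z.im ≠ 0 → ∫ x, g x * f x * (1 / ((x : ℂ) - z)) ∂μ = 0) {w : ℂ} (hw : w.im ≠ 0) :
    ∀ z : ℂ, z.im ≠ 0 → ∫ x, g x * f x * (1 / ((x : ℂ) - w)) * (1 / ((x : ℂ) - z)) ∂μ = 0 := by
  have hgf := integrable_mul_bcf hg f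
  have hne : ∀ z : ℂ, z.im ≠ 0 → z ≠ w →
      ∫ x, g x * f x * (1 / ((x : ℂ) - w)) * (1 / ((x : ℂ) - z)) ∂μ = 0 := by
    intro z hz hzw
    have e : ∀ x : ℝ, g x * f x * (1 / ((x : ℂ) - w)) * (1 / ((x : ℂ) - z)) =
        (1 / (z - w)) * (g x * f x * (1 / ((x : ℂ) - z)) - g x * f x * (1 / ((x : ℂ) - w))) := by
      intro x
      have h1 := ofReal_sub_ne_zero hz x
      have h2 := ofReal_sub_ne_zero hw x
      have h3 := sub_ne_zero.2 hzw
      field_simp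
      ring
    simp only [e]
    rw [integral_const_mul, integral_sub (integrable_mul_resolvent hgf hz)
      (integrable_mul_resolvent hgf hw), h z hz, h w hw]
    simp
  intro z hz
  by_cases hzw : z = w
  swap
  · exact hne z hz hzw
  subst hzw
  -- the case `z = w` is the limit of the points `z + i Im z / (n + 1)`
  have him : ∀ n : ℕ, (z + ((z.im / ((n : ℝ) + 1) : ℝ) : ℂ) * I).im = z.im * (1 + 1 / ((n : ℝ) + 1)) := by
    intro n
    simp only [Complex.add_im, Complex.im_ofReal_mul, Complex.I_im]
    ring
  have him0 : ∀ n : ℕ, (z + ((z.im / ((n : ℝ) + 1) : ℝ) : ℂ) * I).im ≠ 0 := fun n => by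
    rw [him]; exact mul_ne_zero hz (by positivity)
  have hlim : Filter.Tendsto (fun n : ℕ => z + ((z.im / ((n : ℝ) + 1) : ℝ) : ℂ) * I) .atTop (nhds z) := by
    have h1 := (tendsto_one_div_add_atTop_nhds_zero_nat (𝕜 := ℝ)).const_mul z.im
    have h2 := (((Complex.continuous_ofReal.tendsto _).comp h1).mul_const I).const_add z
    simpa [div_eq_mul_inv] using h2
  have key : Filter.Tendsto (fun n : ℕ => ∫ x, g x * f x * (1 / ((x : ℂ) - z)) *
      (1 / ((x : ℂ) - (z + ((z.im / ((n : ℝ) + 1) : ℝ) : ℂ) * I))) ∂μ) .atTop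
      (nhds (∫ x, g x * f x * (1 / ((x : ℂ) - z)) * (1 / ((x : ℂ) - z)) ∂μ)) := by
    have hi := integrable_mul_resolvent hgf hz
    refine tendsto_integral_of_dominated_convergence
      (fun x => ‖g x * f x * (1 / ((x : ℂ) - z))‖ * (1 / |z.im|)) (fun n => ?_) (hi.norm.mul_const _)
      (fun n => .of_forall fun x => ?_) (.of_forall fun x => ?_)
    · exact (integrable_mul_resolvent hi (him0 n)).1
    · rw [norm_mul]
      gcongr
      refine (norm_resolvent_le (him0 n) x).trans ?_
      rw [him, abs_mul]
      refine one_div_le_one_div_of_le (abs_pos.2 hz) (le_mul_of_one_le_right (abs_nonneg _) ?_)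
      rw [abs_of_pos (by positivity)]
      have : 0 ≤ 1 / ((n : ℝ) + 1) := by positivity
      linarith
    · exact (tendsto_const_nhds.div (hlim.const_sub (x : ℂ)) (ofReal_sub_ne_zero hz x)).const_mul _
  refine tendsto_nhds_unique key ?_
  have h0 : ∀ n : ℕ, z + ((z.im / ((n : ℝ) + 1) : ℝ) : ℂ) * I ≠ z := fun n hn => by
    have h1 := congrArg Complex.im hn
    rw [him] at h1
    have h2 : z.im * (1 / ((n : ℝ) + 1)) = 0 := by linarith
    exact mul_ne_zero hz (by positivity) h2
  simp only [hne _ (him0 _) (h0 _)]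
  exact tendsto_const_nhds

/-- An integrable function with vanishing integral and vanishing Stieltjes transform is zero. -/
lemma ae_eq_zero_of_stieltjes {g : ℝ → ℂ} (hg : Integrable g μ) (h0 : ∫ x, g x ∂μ = 0)
    (h : ∀ z : ℂ, z.im ≠ 0 → ∫ x, 1 / ((x : ℂ) - z) * g x ∂μ = 0) : g =ᵐ[μ] 0 := by
  refine ae_eq_zero_of_resolventAlg hg fun r hr => ?_
  have key : ∀ r ∈ resolventAlg, ∀ f : ℝ →ᵇ ℂ, (∫ x, g x * f x ∂μ = 0 ∧
      ∀ z : ℂ, z.im ≠ 0 → ∫ x, g x * f x * (1 / ((x : ℂ) - z)) ∂μ = 0) →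
      (∫ x, g x * (r * f) x ∂μ = 0 ∧
      ∀ z : ℂ, z.im ≠ 0 → ∫ x, g x * (r * f) x * (1 / ((x : ℂ) - z)) ∂μ = 0) := by
    refine resolventAlg_induction ?_ ?_ ?_ ?_
    · rintro w hw - f ⟨-, hf⟩
      have e : ∀ x : ℝ, g x * (resolventBCF w hw * f) x = g x * f x * (1 / ((x : ℂ) - w)) := fun x => by
        rw [BoundedContinuousFunction.mul_apply, resolventBCF_apply]; ring
      simp only [e]
      exact ⟨hf w hw, integral_mul_resolvent_sq hg hf hw⟩
    · rintro c f ⟨hf0, hf⟩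
      have e : ∀ x : ℝ, g x * (algebraMap ℂ (ℝ →ᵇ ℂ) c * f) x = c * (g x * f x) := fun x => by
        rw [BoundedContinuousFunction.mul_apply]
        change g x * (c * f x) = _
        ring
      simp only [e, mul_assoc c, integral_const_mul]
      exact ⟨by rw [hf0, mul_zero], fun z hz => by rw [hf z hz, mul_zero]⟩
    · intro r s hr hs f hf
      obtain ⟨hr0, hr1⟩ := hr f hf
      obtain ⟨hs0, hs1⟩ := hs f hf
      simp only [add_mul r s f, BoundedContinuousFunction.add_apply, mul_add, add_mul]
      refine ⟨?_, fun z hz => ?_⟩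
      · rw [integral_add (integrable_mul_bcf hg _) (integrable_mul_bcf hg _), hr0, hs0, add_zero]
      · rw [integral_add (integrable_mul_resolvent (integrable_mul_bcf hg _) hz)
          (integrable_mul_resolvent (integrable_mul_bcf hg _) hz), hr1 z hz, hs1 z hz,
          add_zero]
    · intro r s hr hs f hf
      rw [mul_assoc]
      exact hr _ (hs f hf)
  have := (key r hr 1 ⟨by simpa using h0, fun z hz => by simpa [mul_comm] using h z hz⟩).1
  simpa using this

end Stieltjes

/-! ### N-extremal measures and density of the polynomials -/

section NExtremal

variable {μ : Measure ℝ} {p : ℕ → ℝ[X]} {κ l : ℝ → ℝ}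

lemma norm_ofReal_div_le_one (x : ℝ) : ‖1 / ((x : ℂ) - I) * x‖ ≤ 1 := by
  rw [norm_mul, norm_div, norm_one, one_div, inv_mul_le_one₀ (norm_pos_iff.2
    (ofReal_sub_ne_zero (by simp) x))]
  simpa using Complex.abs_re_le_norm ((x : ℂ) - I)

lemma memLp_resolvent_mul_id {f : ℝ → ℂ} (hf : MemLp f 2 μ) :
    MemLp (fun x : ℝ => 1 / ((x : ℂ) - I) * (x * f x)) 2 μ := by
  refine hf.mono (((continuous_resolvent (z := I) (by simp)).aestronglyMeasurable.mul
    (Complex.continuous_ofReal.aestronglyMeasurable.mul hf.1))) (.of_forall fun x => ?_)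
  rw [← mul_assoc, norm_mul]
  exact mul_le_of_le_one_left (norm_nonneg _) (norm_ofReal_div_le_one x)

namespace IsNevanlinnaPair

lemma integral_kappa_mul_X (h : IsNevanlinnaPair μ p κ l) (P : ℂ[X]) :
    ∫ x, ((x : ℂ) * κ x) * P.eval (x : ℂ) ∂μ = 0 := by
  have := h.integral_kappa (X * P)
  simp only [eval_mul, eval_X, zero_mul] at this
  rw [← this]
  congr 1; ext x; ring

lemma integral_l_mul_X (h : IsNevanlinnaPair μ p κ l) (P : ℂ[X]) :
    ∫ x, ((x : ℂ) * l x) * P.eval (x : ℂ) ∂μ = ∫ x, P.eval (x : ℂ) ∂μ := by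
  have := h.integral_l (X * P)
  rw [quotPoly_unique (Q := P) (c := 0) (by simp)] at this
  rw [← this]
  congr 1; ext x; simp; ring

lemma integral_kappa_one (h : IsNevanlinnaPair μ p κ l) : ∫ x, (κ x : ℂ) ∂μ = 1 := by
  simpa using h.integral_kappa 1

/-- For `ξ = b l + a κ`, the function `x ξ - b` is orthogonal to the polynomials. -/
lemma integral_defect (hm : HasMoments μ) (h : IsNevanlinnaPair μ p κ l) (a b : ℂ) (P : ℂ[X]) :
    ∫ x, ((x : ℂ) * (b * l x + a * κ x) - b) * P.eval (x : ℂ) ∂μ = 0 := by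
  have e : ∀ x : ℝ, ((x : ℂ) * (b * l x + a * κ x) - b) * P.eval (x : ℂ) =
      b * (((x : ℂ) * l x) * P.eval (x : ℂ)) + a * (((x : ℂ) * κ x) * P.eval (x : ℂ)) -
        b * P.eval (x : ℂ) := fun x => by ring
  have e' : ∀ (f : ℝ → ℂ) (x : ℝ), (x : ℂ) * f x * P.eval (x : ℂ) = f x * (X * P).eval (x : ℂ) :=
    fun f x => by simp; ring
  have i1 : Integrable (fun x : ℝ => b * (((x : ℂ) * l x) * P.eval (x : ℂ))) μ := by
    simp only [e' fun x => (l x : ℂ)]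
    exact (integrable_fun_mul h.approx_l.1 (hm.memLp _)).const_mul _
  have i2 : Integrable (fun x : ℝ => a * (((x : ℂ) * κ x) * P.eval (x : ℂ))) μ := by
    simp only [e' fun x => (κ x : ℂ)]
    exact (integrable_fun_mul h.approx_kappa.1 (hm.memLp _)).const_mul _
  have i3 : Integrable (fun x : ℝ => b * (((x : ℂ) * l x) * P.eval (x : ℂ)) +
      a * (((x : ℂ) * κ x) * P.eval (x : ℂ))) μ := i1.add i2
  simp only [e]
  rw [integral_sub i3 ((hm.integrable_ceval P).const_mul _), integral_add i1 i2, integral_const_mul,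
    integral_const_mul, integral_const_mul, h.integral_kappa_mul_X, h.integral_l_mul_X]
  ring

lemma approx_comb (hm : HasMoments μ) (h : IsNevanlinnaPair μ p κ l) (a b : ℂ) :
    PolyApprox μ fun x => b * l x + a * κ x :=
  (h.approx_l.const_mul b).add hm (h.approx_kappa.const_mul a)

lemma memLp_defect (hm : HasMoments μ) (h : IsNevanlinnaPair μ p κ l) (a b : ℂ) :
    MemLp (fun x : ℝ => 1 / ((x : ℂ) - I) * ((x : ℂ) * (b * l x + a * κ x) - b)) 2 μ := by
  have := hm.isFiniteMeasure
  simp only [mul_sub]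
  refine memLp_fun_sub (memLp_resolvent_mul_id (h.approx_comb hm a b).1) ?_
  exact (memLp_resolvent (by simp)).mul_const b

/-- `b (A + F B) + a (C + F D)` is the Stieltjes transform of `(x ξ - b) dμ`, `ξ = b l + a κ`. -/
lemma nev_comb (hm : HasMoments μ) (h : IsNevanlinnaPair μ p κ l) (a b : ℂ) {z : ℂ} (hz : z.im ≠ 0) :
    (b * nevA μ p z + a * nevC μ p z) +
      stieltjesTransform μ z * (b * nevB μ p z + a * nevD p z) =
    ∫ x, 1 / ((x : ℂ) - z) * ((x : ℂ) * (b * l x + a * κ x) - b) ∂μ := by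
  have := hm.isFiniteMeasure
  have hx := memLp_id hm
  have i1 : Integrable (fun x : ℝ => 1 / ((x : ℂ) - z) * ((x : ℂ) * l x - 1)) μ := by
    have : Integrable (fun x : ℝ => (x : ℂ) * l x - 1) μ :=
      (integrable_fun_mul hx h.approx_l.1).sub (integrable_const 1)
    exact (integrable_mul_resolvent this hz).congr (.of_forall fun x => mul_comm _ _)
  have i2 : Integrable (fun x : ℝ => 1 / ((x : ℂ) - z) * ((x : ℂ) * κ x)) μ := by
    exact (integrable_mul_resolvent (integrable_fun_mul hx h.approx_kappa.1) hz).congr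
      (.of_forall fun x => mul_comm _ _)
  have e : ∀ x : ℝ, 1 / ((x : ℂ) - z) * ((x : ℂ) * (b * l x + a * κ x) - b) =
      b * (1 / ((x : ℂ) - z) * (x * l x - 1)) + a * (1 / ((x : ℂ) - z) * (x * κ x)) := fun x => by ring
  simp only [e]
  rw [integral_add (i1.const_mul _) (i2.const_mul _), integral_const_mul, integral_const_mul,
    ← h.nevA_add z hz, ← h.nevC_add z hz]
  ring

lemma denominator_eq (h : IsNevanlinnaPair μ p κ l) (a b : ℂ) {z : ℂ}
    {k : ℝ → ℂ} (hk : PolyApprox μ k)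
    (hD : nevD p z = z * ∫ x, (κ x : ℂ) * k x ∂μ) (hB : nevB μ p z = -1 + z * ∫ x, (l x : ℂ) * k x ∂μ) :
    b * nevB μ p z + a * nevD p z = -b + z * ∫ x, (b * l x + a * κ x) * k x ∂μ := by
  simp only [add_mul, mul_assoc]
  rw [integral_add ((integrable_fun_mul h.approx_l.1 hk.1).const_mul _)
    ((integrable_fun_mul h.approx_kappa.1 hk.1).const_mul _), integral_const_mul, integral_const_mul,
    hD, hB]
  ring

end IsNevanlinnaPair

/-- The imaginary part of the Stieltjes transform has the sign of that of `z`. -/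
lemma stieltjesTransform_ne_zero (hμ : μ ∈ MStar) {z : ℂ} (hz : z.im ≠ 0) :
    stieltjesTransform μ z ≠ 0 := by
  have hm : HasMoments μ := hμ.2
  have := hm.isFiniteMeasure
  intro h
  have hR : Integrable (fun x : ℝ => 1 / ((x : ℂ) - z)) μ :=
    (memLp_resolvent hz).integrable (by norm_num)
  have e : ∀ x : ℝ, (1 / ((x : ℂ) - z)).im = z.im * (1 / Complex.normSq ((x : ℂ) - z)) := by
    intro x
    rw [one_div, Complex.inv_im]
    simp [div_eq_mul_inv]
  have him : ∫ x : ℝ, z.im * (1 / Complex.normSq ((x : ℂ) - z)) ∂μ = 0 := by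
    have := integral_im hR
    simp only [RCLike.im_to_complex, e] at this
    rw [this, ← stieltjesTransform, h, Complex.zero_im]
  rw [integral_const_mul, mul_eq_zero, or_iff_right hz] at him
  have hpos : ∀ x : ℝ, 0 < 1 / Complex.normSq ((x : ℂ) - z) := fun x =>
    one_div_pos.2 (Complex.normSq_pos.2 (ofReal_sub_ne_zero hz x))
  rw [integral_eq_zero_iff_of_nonneg (fun x => (hpos x).le)] at him
  · have h0 : ∀ᵐ x ∂μ, False := him.mono fun x hx => (hpos x).ne' hx
    have : μ = 0 := by rwa [Filter.eventually_false_iff_eq_bot, ae_eq_bot] at h0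
    exact hμ.1 (by rw [this, Measure.support_zero]; exact Set.finite_empty)
  · have := hR.im.const_mul (z.im)⁻¹
    simp only [RCLike.im_to_complex, e] at this
    simpa only [inv_mul_cancel_left₀ hz] using this

/-- If `x ξ = b` almost everywhere for `ξ = b l + a κ` and the denominator `b B + a D` does not vanish
at `i`, then `1 / (x - i)` is a limit of polynomials. Indeed, if polynomials `T = T(i) + (x - i) R`
converge to `(x - i) ξ = b - i ξ`, then `T(i)` converges to `-(b B + a D)(i)`, so that
`1 / (x - i)` is approximated by multiples of `ξ - R`. -/
lemma IsNevanlinnaPair.resolventApprox (hm : HasMoments μ) (h : IsNevanlinnaPair μ p κ l) {a b : ℂ}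
    (hξ : ∀ᵐ x : ℝ ∂μ, (x : ℂ) * (b * l x + a * κ x) = b)
    (hN : b * nevB μ p I + a * nevD p I ≠ 0) : ResolventApprox μ := by
  have := hm.isFiniteMeasure
  obtain ⟨k, hk, hkP, hD, hB⟩ := h.exists_kernel I (by simp)
  rw [h.denominator_eq a b hk hD hB] at hN
  set ξ : ℝ → ℂ := fun x => b * l x + a * κ x with hξd
  have hξa : PolyApprox μ ξ := h.approx_comb hm a b
  set c : ℂ := b - I * ∫ x, ξ x * k x ∂μ with hc
  have hc0 : c ≠ 0 := fun h0 => hN (by linear_combination -h0)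
  have hτ : PolyApprox μ fun x => b + (-I) * ξ x := by
    have h1 : PolyApprox μ fun _ : ℝ => b := by simpa using PolyApprox.poly hm (C b)
    exact h1.add hm (hξa.const_mul (-I))
  have hτk : ∫ x, k x * (b + (-I) * ξ x) ∂μ = c := by
    have e : ∀ x, k x * (b + (-I) * ξ x) = b * k x - I * (ξ x * k x) := fun x => by ring
    simp only [e]
    rw [integral_sub ((hk.1.integrable (by norm_num)).const_mul _)
      ((integrable_fun_mul hξa.1 hk.1).const_mul _), integral_const_mul, integral_const_mul]
    have := hkP 1
    simp only [eval_one, mul_one] at this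
    rw [this, hc, mul_one]
  refine .of_approx (memLp_resolvent (by simp)) (fun ε hε => ?_) hm
  have hk0 := l2sq_nonneg μ k
  have hK0 := l2sq_nonneg μ fun _ => 1
  set M := 2 + 2 * (l2sq μ k * l2sq μ fun _ => 1) with hM
  have hM0 : 0 < M := by positivity
  obtain ⟨T, hT⟩ := hτ.2 (ε * ‖c‖ ^ 2 / M) (by have := norm_pos_iff.2 hc0; positivity)
  have hTk : ‖c - T.eval I‖ ^ 2 ≤ l2sq μ k * l2sq μ (fun x => b + (-I) * ξ x - T.eval (x : ℂ)) := by
    rw [← hτk, ← hkP T, ← integral_sub (integrable_fun_mul hk.1 hτ.1)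
      (integrable_fun_mul hk.1 (hm.memLp T))]
    simp only [← mul_sub]
    exact norm_integral_mul_sq_le hk.1 (memLp_fun_sub hτ.1 (hm.memLp T))
  refine ⟨fun x => c⁻¹ * (ξ x + (-quotPoly T I).eval (x : ℂ)),
    (hξa.add hm (.poly hm _)).const_mul _, ?_⟩
  have e : ∀ᵐ x : ℝ ∂μ, 1 / ((x : ℂ) - I) - c⁻¹ * (ξ x + (-quotPoly T I).eval (x : ℂ)) =
      c⁻¹ * (1 / ((x : ℂ) - I) * ((c - T.eval I) - (b + (-I) * ξ x - T.eval (x : ℂ)))) := by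
    filter_upwards [hξ] with x hx
    have h0 := ofReal_sub_ne_zero (z := I) (by simp) x
    have h1 : (x : ℂ) * ξ x = b := hx
    rw [eval_eq_add_quotPoly T I (x : ℂ), eval_neg, ← h1]
    field_simp
    ring
  have e' : l2sq μ (fun x : ℝ => 1 / ((x : ℂ) - I) - c⁻¹ * (ξ x + (-quotPoly T I).eval (x : ℂ))) =
      l2sq μ (fun x : ℝ => c⁻¹ * (1 / ((x : ℂ) - I) *
        ((c - T.eval I) - (b + (-I) * ξ x - T.eval (x : ℂ))))) :=
    integral_congr_ae (e.mono fun x hx => by simp only; rw [hx])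
  rw [e', l2sq_const_mul, norm_inv, inv_pow, inv_mul_lt_iff₀ (by have := norm_pos_iff.2 hc0; positivity)]
  set δ := l2sq μ (fun x => b + (-I) * ξ x - T.eval (x : ℂ)) with hδ
  have h1 : MemLp (fun _ : ℝ => c - T.eval I) 2 μ := memLp_const _
  have h2 := memLp_fun_sub hτ.1 (hm.memLp T)
  have h3 : l2sq μ (fun _ : ℝ => c - T.eval I) = ‖c - T.eval I‖ ^ 2 * l2sq μ fun _ => 1 := by
    rw [← l2sq_const_mul]; simp
  calc _ ≤ l2sq μ (fun x => (c - T.eval I) + (-1) * (b + (-I) * ξ x - T.eval (x : ℂ))) := by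
        refine l2sq_mono (h1.add (h2.const_mul (-1))) fun x => ?_
        rw [norm_mul, neg_one_mul, ← sub_eq_add_neg]
        refine mul_le_of_le_one_left (norm_nonneg _) ?_
        simpa using norm_resolvent_le (z := I) (by simp) x
    _ ≤ 2 * l2sq μ (fun _ : ℝ => c - T.eval I) +
        2 * l2sq μ (fun x => (-1) * (b + (-I) * ξ x - T.eval (x : ℂ))) :=
        l2sq_add_le h1 (h2.const_mul (-1))
    _ = 2 * (‖c - T.eval I‖ ^ 2 * l2sq μ fun _ => 1) + 2 * δ := by
        rw [h3, l2sq_const_mul, ← hδ]; simp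
    _ ≤ 2 * ((l2sq μ k * δ) * l2sq μ fun _ => 1) + 2 * δ := by gcongr
    _ = M * δ := by rw [hM]; ring
    _ < M * (ε * ‖c‖ ^ 2 / M) := by gcongr
    _ = ‖c‖ ^ 2 * ε := by field_simp

/-- The polynomials are dense in `L²(μ)` for N-extremal measures. -/
lemma resolventApprox_of_mem_Mi0 (hμ : μ ∈ Mi0) : ResolventApprox μ := by
  obtain ⟨hi, p, hp, t, ht⟩ := hμ
  have hM := hi.1
  have hm : HasMoments μ := hM.2
  have hE := (mem_Mi_iff hM).1 hi
  obtain ⟨κ, l, h⟩ := exists_nevanlinnaPair hm hp hE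
  obtain ⟨a, b, hab⟩ : ∃ a b : ℂ, ∀ z : ℂ, z.im ≠ 0 → stieltjesTransform μ z =
      -(b * nevA μ p z + a * nevC μ p z) / (b * nevB μ p z + a * nevD p z) := by
    cases t with
    | infty => exact ⟨1, 0, fun z hz => by rw [ht z hz]; simp [nevFraction]⟩
    | coe t => exact ⟨t, 1, fun z hz => by rw [ht z hz]; simp [nevFraction]⟩
  have hnz : ∀ z : ℂ, z.im ≠ 0 → b * nevB μ p z + a * nevD p z ≠ 0 := fun z hz hN =>
    stieltjesTransform_ne_zero hM hz (by rw [hab z hz, hN, div_zero])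
  refine h.resolventApprox hm (a := a) (b := b) ?_ (hnz I (by simp))
  have := hm.isFiniteMeasure
  have hg : Integrable (fun x : ℝ => (x : ℂ) * (b * l x + a * κ x) - b) μ :=
    (integrable_fun_mul (memLp_id hm) (h.approx_comb hm a b).1).sub (integrable_const b)
  have := ae_eq_zero_of_stieltjes hg (by simpa using h.integral_defect hm a b 1) fun z hz => by
    rw [← h.nev_comb hm a b hz, hab z hz, div_mul_cancel₀ _ (hnz z hz)]
    ring
  exact this.mono fun x hx => sub_eq_zero.1 hx

/-- When the polynomials are dense, the functions `w ∈ L²(μ)` orthogonal to all `(x - i) P` form a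
space of dimension at most one. -/
lemma ResolventApprox.exists_linear_relation (hm : HasMoments μ) (hA : ResolventApprox μ)
    {w₁ w₂ : ℝ → ℂ} (h₁ : MemLp w₁ 2 μ) (h₂ : MemLp w₂ 2 μ)
    (h₁' : ∀ P : ℂ[X], ∫ x : ℝ, w₁ x * (((x : ℂ) - I) * P.eval (x : ℂ)) ∂μ = 0)
    (h₂' : ∀ P : ℂ[X], ∫ x : ℝ, w₂ x * (((x : ℂ) - I) * P.eval (x : ℂ)) ∂μ = 0) :
    ∃ α β : ℂ, (α ≠ 0 ∨ β ≠ 0) ∧ ∀ᵐ x ∂μ, α * w₁ x + β * w₂ x = 0 := by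
  have := hm.isFiniteMeasure
  obtain ⟨α, β, hne, h0⟩ : ∃ α β : ℂ, (α ≠ 0 ∨ β ≠ 0) ∧ α * ∫ x, w₁ x ∂μ + β * ∫ x, w₂ x ∂μ = 0 := by
    by_cases h : ∫ x, w₁ x ∂μ = 0
    · exact ⟨1, 0, .inl one_ne_zero, by rw [h]; ring⟩
    · exact ⟨∫ x, w₂ x ∂μ, -∫ x, w₁ x ∂μ, .inr (neg_ne_zero.2 h), by ring⟩
  refine ⟨α, β, hne, hA.ae_eq_zero hm ((h₁.const_mul α).add (h₂.const_mul β)) fun P => ?_⟩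
  have key : ∀ {w : ℝ → ℂ}, MemLp w 2 μ →
      (∀ P : ℂ[X], ∫ x : ℝ, w x * (((x : ℂ) - I) * P.eval (x : ℂ)) ∂μ = 0) →
      ∫ x, w x * P.eval (x : ℂ) ∂μ = P.eval I * ∫ x, w x ∂μ := by
    intro w hw hw'
    have i1 : Integrable (fun x : ℝ => w x * (((x : ℂ) - I) * (quotPoly P I).eval (x : ℂ))) μ := by
      refine (integrable_fun_mul hw (hm.memLp ((X - C I) * quotPoly P I))).congr
        (.of_forall fun x => ?_)
      simp
    have e : ∀ x : ℝ, w x * P.eval (x : ℂ) =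
        P.eval I * w x + w x * (((x : ℂ) - I) * (quotPoly P I).eval (x : ℂ)) := fun x => by
      rw [eval_eq_add_quotPoly P I (x : ℂ)]; ring
    simp only [e]
    rw [integral_add ((hw.integrable (by norm_num)).const_mul _) i1, hw', add_zero,
      integral_const_mul]
  simp only [add_mul, mul_assoc]
  rw [integral_add ((integrable_fun_mul h₁ (hm.memLp P)).const_mul _)
    ((integrable_fun_mul h₂ (hm.memLp P)).const_mul _), integral_const_mul, integral_const_mul,
    key h₁ h₁', key h₂ h₂']
  linear_combination P.eval I * h0

lemma resolvent_mul_cancel (g : ℝ → ℂ) (P : ℂ[X]) (x : ℝ) :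
    1 / ((x : ℂ) - I) * g x * (((x : ℂ) - I) * P.eval (x : ℂ)) = g x * P.eval (x : ℂ) := by
  have := ofReal_sub_ne_zero (z := I) (by simp) x
  field_simp

/-- When the polynomials are dense, there is a real combination `ξ = b l + a κ` with `x ξ = b`. -/
lemma IsNevanlinnaPair.exists_real_relation (hm : HasMoments μ) (h : IsNevanlinnaPair μ p κ l)
    (hA : ResolventApprox μ) : ∃ a b : ℝ, (a ≠ 0 ∨ b ≠ 0) ∧
      ∀ᵐ x ∂μ, x * (b * l x + a * κ x) = b := by
  obtain ⟨α, β, hne, hαβ⟩ := hA.exists_linear_relation hm (h.memLp_defect hm 1 0) (h.memLp_defect hm 0 1)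
    (fun P => by
      simp only [resolvent_mul_cancel fun x : ℝ => (x : ℂ) * (0 * l x + 1 * κ x) - 0]
      exact h.integral_defect hm 1 0 P)
    (fun P => by
      simp only [resolvent_mul_cancel fun x : ℝ => (x : ℂ) * (1 * l x + 0 * κ x) - 1]
      exact h.integral_defect hm 0 1 P)
  have hrel : ∀ᵐ x : ℝ ∂μ, (x : ℂ) * (β * l x + α * κ x) = β := by
    filter_upwards [hαβ] with x hx
    have h0 := ofReal_sub_ne_zero (z := I) (by simp) x
    field_simp at hx
    linear_combination hx
  have hre : ∀ᵐ x ∂μ, x * (β.re * l x + α.re * κ x) = β.re := hrel.mono fun x hx => by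
    simpa using congrArg Complex.re hx
  have him : ∀ᵐ x ∂μ, x * (β.im * l x + α.im * κ x) = β.im := hrel.mono fun x hx => by
    simpa using congrArg Complex.im hx
  by_cases hz : α.re ≠ 0 ∨ β.re ≠ 0
  · exact ⟨_, _, hz, hre⟩
  · refine ⟨_, _, ?_, him⟩
    push Not at hz
    by_contra! h0
    rcases hne with h1 | h1
    · exact h1 (Complex.ext hz.1 h0.1)
    · exact h1 (Complex.ext hz.2 h0.2)

/-- The denominator `b B + a D` has no nonreal zeros if `x ξ = b` for `ξ = b l + a κ`. With
`ξ' = -a l + b κ` the function `x ξ' + a` spans the annihilator of the polynomials, which contains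
`(x - z) k` for the reproducing kernel `k` at `z`. This determines `∫ ξ k dμ`. -/
lemma IsNevanlinnaPair.denominator_ne_zero (hm : HasMoments μ) (h : IsNevanlinnaPair μ p κ l)
    (hA : ResolventApprox μ) {a b : ℝ} (hab : a ≠ 0 ∨ b ≠ 0)
    (hξ : ∀ᵐ x ∂μ, x * (b * l x + a * κ x) = b) {z : ℂ} (hz : z.im ≠ 0) :
    (b : ℂ) * nevB μ p z + a * nevD p z ≠ 0 := by
  have := hm.isFiniteMeasure
  have hsum : (a : ℂ) ^ 2 + b ^ 2 ≠ 0 := by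
    have : a ^ 2 + b ^ 2 ≠ 0 := by
      rcases hab with h | h <;> positivity
    exact_mod_cast this
  have hξ' : ∀ᵐ x : ℝ ∂μ, (x : ℂ) * (b * l x + a * κ x) = b := hξ.mono fun x hx => by
    exact_mod_cast congrArg (fun y : ℝ => (y : ℂ)) hx
  obtain ⟨k, hk, hkP, hD, hB⟩ := h.exists_kernel z hz
  have hk1 : ∫ x, k x ∂μ = 1 := by simpa using hkP 1
  have hw : MemLp (fun x : ℝ => 1 / ((x : ℂ) - I) * (((x : ℂ) - z) * k x)) 2 μ := by
    simp only [sub_mul, mul_sub]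
    exact memLp_fun_sub (memLp_resolvent_mul_id hk.1)
      (memLp_resolvent_mul (hk.1.const_mul z) (by simp))
  obtain ⟨α, β, hne, hαβ⟩ := hA.exists_linear_relation hm hw (h.memLp_defect hm b (-a))
    (fun P => by
      simp only [resolvent_mul_cancel fun x : ℝ => ((x : ℂ) - z) * k x]
      have := hkP ((X - C z) * P)
      simp only [eval_mul, eval_sub, eval_X, eval_C, sub_self, zero_mul] at this
      rw [← this]
      congr 1; ext x; ring)
    (fun P => by
      simp only [resolvent_mul_cancel fun x : ℝ => (x : ℂ) * (-a * l x + b * κ x) - -a]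
      exact h.integral_defect hm b (-a) P)
  have hrel : ∀ᵐ x : ℝ ∂μ, α * (((x : ℂ) - z) * k x) + β * (x * (-a * l x + b * κ x) - -a) = 0 := by
    filter_upwards [hαβ] with x hx
    have h0 := ofReal_sub_ne_zero (z := I) (by simp) x
    field_simp at hx
    linear_combination hx
  have hα : α ≠ 0 := by
    rintro rfl
    have hβ : β ≠ 0 := by simpa using hne
    -- otherwise `x κ = 0` and `x l = 1`, so that `κ = 0`
    have h0 : ∀ᵐ x ∂μ, (κ x : ℂ) = 0 := by
      filter_upwards [hrel, hξ'] with x h1 h2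
      have h3 : (x : ℂ) * (-a * l x + b * κ x) - -a = 0 := by simpa [hβ] using h1
      have h4 : (x : ℂ) * κ x = 0 := by
        refine (mul_eq_zero.1 ?_).resolve_left hsum
        linear_combination b * h3 + a * h2
      have h5 : (x : ℂ) * l x = 1 := by
        have : ((a : ℂ) ^ 2 + b ^ 2) * (x * l x - 1) = 0 := by linear_combination b * h2 - a * h3
        exact sub_eq_zero.1 ((mul_eq_zero.1 this).resolve_left hsum)
      linear_combination l x * h4 - κ x * h5
    have := integral_congr_ae h0
    rw [h.integral_kappa_one] at this
    simp at this
  have hβ : β ≠ 0 := by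
    rintro rfl
    have h0 : k =ᵐ[μ] 0 := by
      filter_upwards [hrel] with x hx
      have := ofReal_sub_ne_zero hz x
      simpa [hα, this] using hx
    have := integral_congr_ae h0
    rw [hk1] at this
    simp at this
  intro hN
  rw [h.denominator_eq a b hk hD hB] at hN
  have hξk := integrable_fun_mul (h.approx_comb hm a b).1 hk.1
  have e1 : ∫ x, ((b : ℂ) * k x - z * ((b * l x + a * κ x) * k x)) ∂μ = 0 := by
    rw [integral_sub ((hk.1.integrable (by norm_num)).const_mul _) (hξk.const_mul _),
      integral_const_mul, integral_const_mul, hk1]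
    linear_combination -hN
  have e2 : ∀ᵐ x ∂μ, α * ((b : ℂ) * k x - z * ((b * l x + a * κ x) * k x)) =
      -β * ((b : ℂ) * (-a * l x + b * κ x) + a * (b * l x + a * κ x)) := by
    filter_upwards [hrel, hξ'] with x h1 h2
    linear_combination (b * (l x : ℂ) + a * κ x) * h1 -
      (α * k x + β * (-a * l x + b * κ x)) * h2
  have e3 := integral_congr_ae e2
  rw [integral_const_mul, e1, mul_zero] at e3
  have e4 : ∀ x, -β * ((b : ℂ) * (-a * l x + b * κ x) + a * (b * l x + a * κ x)) =
      -β * ((a : ℂ) ^ 2 + b ^ 2) * κ x := fun x => by ring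
  simp only [e4] at e3
  rw [integral_const_mul, h.integral_kappa_one, mul_one] at e3
  exact mul_ne_zero (neg_ne_zero.2 hβ) hsum e3.symm

/-- An indeterminate measure for which the polynomials are dense is N-extremal. -/
lemma mem_Mi0_of_resolventApprox (hi : μ ∈ Mi) (hA : ResolventApprox μ) : μ ∈ Mi0 := by
  have hM := hi.1
  have hm : HasMoments μ := hM.2
  obtain ⟨p, hp⟩ := exists_isOrthonormalPolys hM
  obtain ⟨κ, l, h⟩ := exists_nevanlinnaPair hm hp ((mem_Mi_iff hM).1 hi)
  obtain ⟨a, b, hab, hξ⟩ := h.exists_real_relation hm hA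
  have hden := fun {z : ℂ} (hz : z.im ≠ 0) => h.denominator_ne_zero hm hA hab hξ hz
  have hF : ∀ z : ℂ, z.im ≠ 0 → stieltjesTransform μ z =
      -(b * nevA μ p z + a * nevC μ p z) / (b * nevB μ p z + a * nevD p z) := by
    intro z hz
    have h1 := h.nev_comb hm a b hz
    have h2 : ∫ x, 1 / ((x : ℂ) - z) * ((x : ℂ) * (b * l x + a * κ x) - b) ∂μ = 0 := by
      refine integral_eq_zero_of_ae ?_
      filter_upwards [hξ] with x hx
      have : (x : ℂ) * (b * l x + a * κ x) = b := by exact_mod_cast congrArg (fun y : ℝ => (y : ℂ)) hx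
      rw [this, sub_self, mul_zero]
      rfl
    rw [h2] at h1
    rw [eq_div_iff (hden hz)]
    linear_combination h1
  refine ⟨hi, p, hp, ?_⟩
  by_cases hb : b = 0
  · subst hb
    have ha : (a : ℂ) ≠ 0 := by simpa using hab
    refine ⟨none, fun z hz => ?_⟩
    rw [hF z hz]
    simp only [nevFraction, Complex.ofReal_zero, zero_mul, zero_add]
    rw [← mul_neg, mul_div_mul_left _ _ ha]
  · have hb' : (b : ℂ) ≠ 0 := by exact_mod_cast hb
    refine ⟨some (a / b), fun z hz => ?_⟩
    rw [hF z hz]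
    simp only [nevFraction]
    push_cast
    have e1 : (b : ℂ) * nevA μ p z + a * nevC μ p z = b * (nevA μ p z + a / b * nevC μ p z) := by
      field_simp
    have e2 : (b : ℂ) * nevB μ p z + a * nevD p z = b * (nevB μ p z + a / b * nevD p z) := by
      field_simp
    rw [e1, e2, ← mul_neg, mul_div_mul_left _ _ hb']

end NExtremal

/-! ### Measures weighted by powers of `1 + x²` -/

section Weighted

variable {μ : Measure ℝ}

lemma one_add_sq_pos (x : ℝ) : 0 < 1 + x ^ 2 := by positivity

lemma measurable_weight (α : ℝ) : Measurable fun x : ℝ => ENNReal.ofReal ((1 + x ^ 2) ^ α) := by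
  fun_prop

lemma weighted_weighted (α β : ℝ) (μ : Measure ℝ) :
    weighted α (weighted β μ) = weighted (α + β) μ := by
  rw [weighted, weighted, weighted, ← withDensity_mul _ (measurable_weight β) (measurable_weight α)]
  congr 1
  ext x
  rw [Pi.mul_apply, ← ENNReal.ofReal_mul (Real.rpow_nonneg (one_add_sq_pos x).le _),
    ← Real.rpow_add (one_add_sq_pos x), add_comm β α]

lemma weighted_zero (μ : Measure ℝ) : weighted 0 μ = μ := by
  simp [weighted]

lemma weighted_mono {α β : ℝ} (h : α ≤ β) (μ : Measure ℝ) : weighted α μ ≤ weighted β μ := by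
  refine withDensity_mono (.of_forall fun x => ENNReal.ofReal_le_ofReal ?_)
  exact Real.rpow_le_rpow_of_exponent_le (le_add_of_nonneg_right (sq_nonneg x)) h

lemma weighted_mem_MStar (hμ : μ ∈ MStar) (α : ℝ) : weighted α μ ∈ MStar := by
  have hm : HasMoments μ := hμ.2
  refine ⟨hμ.1.mono (Measure.AbsolutelyContinuous.support_mono ?_), fun n => ?_⟩
  · refine withDensity_absolutelyContinuous' (measurable_weight α).aemeasurable (.of_forall fun x => ?_)
    exact (ENNReal.ofReal_pos.2 (Real.rpow_pos_of_pos (one_add_sq_pos x) _)).ne'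
  · obtain ⟨m, hαm⟩ := exists_nat_ge α
    rw [weighted, integrable_withDensity_iff_integrable_smul' (measurable_weight α) (by simp)]
    have hi := hm.integrable_eval ((1 + X ^ 2) ^ m * (1 + (X ^ n) ^ 2))
    refine hi.mono' (by fun_prop) (.of_forall fun x => ?_)
    have h1 := one_add_sq_pos x
    have h2 : (1 + x ^ 2) ^ α ≤ (1 + x ^ 2) ^ m := by
      rw [← Real.rpow_natCast (1 + x ^ 2) m]
      exact Real.rpow_le_rpow_of_exponent_le (le_add_of_nonneg_right (sq_nonneg x)) hαm
    rw [ENNReal.toReal_ofReal (Real.rpow_nonneg h1.le _), norm_smul,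
      Real.norm_of_nonneg (Real.rpow_nonneg h1.le _)]
    simp only [eval_mul, eval_pow, eval_add, eval_one, eval_X, Real.norm_eq_abs]
    gcongr
    nlinarith [sq_abs (x ^ n), sq_nonneg (|x ^ n| - 1), abs_nonneg (x ^ n)]

lemma weighted_mem_Mi_mono (hμ : μ ∈ MStar) {α β : ℝ} (h : α ≤ β) (hα : weighted α μ ∈ Mi) :
    weighted β μ ∈ Mi := by
  have hβ := weighted_mem_MStar hμ β
  rw [mem_Mi_iff hβ]
  exact ((mem_Mi_iff hα.1).1 hα).mono_measure hβ.2 (weighted_mono h μ)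

lemma l2sq_weighted_one (μ : Measure ℝ) (P : ℂ[X]) :
    l2sq (weighted 1 μ) (fun x : ℝ => 1 / ((x : ℂ) - I) - P.eval (x : ℂ)) =
      l2sq μ fun x => (1 - (X - C I) * P).eval (x : ℂ) := by
  rw [l2sq, weighted, integral_withDensity_eq_integral_toReal_smul (measurable_weight 1) (by simp)]
  refine integral_congr_ae (.of_forall fun x => ?_)
  have h0 := ofReal_sub_ne_zero (z := I) (by simp) x
  have h1 : 1 + x ^ 2 = ‖(x : ℂ) - I‖ ^ 2 := by
    rw [← Complex.normSq_eq_norm_sq, Complex.normSq_apply]; simp; ring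
  simp only [Real.rpow_one]
  rw [ENNReal.toReal_ofReal (one_add_sq_pos x).le, smul_eq_mul, h1, ← mul_pow, ← norm_mul]
  congr 2
  simp only [eval_sub, eval_one, eval_mul, eval_X, eval_C]
  field_simp

/-- Multiplication by `x - i` is an isometry from `L²((1 + x²) dμ)` to `L²(μ)`. Hence the polynomials
are dense in the former space if and only if the evaluation at `i` is unbounded in `L²(μ)`. -/
lemma resolventApprox_weighted_one_iff (hμ : μ ∈ MStar) :
    ResolventApprox (weighted 1 μ) ↔ ¬ BoundedEval μ := by
  rw [not_boundedEval_iff]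
  constructor
  · intro h ε hε
    obtain ⟨P, hP⟩ := h.2 ε hε
    rw [l2sq_weighted_one] at hP
    exact ⟨_, by simp, hP⟩
  · intro h
    have : IsFiniteMeasure (weighted 1 μ) := HasMoments.isFiniteMeasure (weighted_mem_MStar hμ 1).2
    refine ⟨memLp_resolvent (by simp), fun ε hε => ?_⟩
    obtain ⟨S, hS, hlt⟩ := h ε hε
    refine ⟨-quotPoly S I, ?_⟩
    rw [l2sq_weighted_one]
    convert! hlt using 4
    have := eq_add_quotPoly S I
    rw [hS, C_1] at this
    linear_combination -this

lemma weighted_neg_one_notMem_Mi (hμ : μ ∈ MStar) (hA : ResolventApprox μ) : weighted (-1) μ ∉ Mi := by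
  have h := weighted_mem_MStar hμ (-1)
  rw [mem_Mi_iff h, ← resolventApprox_weighted_one_iff h, weighted_weighted]
  norm_num
  rwa [weighted_zero]

lemma mem_setAα_iff (hμ : μ ∈ Mi) (α : ℝ) : μ ∈ setAα α ↔ weighted (-α) μ ∈ Mi := by
  simp [setAα, hμ]

lemma zero_mem_indices (hμ : μ ∈ Mi) : (0 : ℝ) ∈ {α : ℝ | α ∈ Set.Icc (0 : ℝ) 1 ∧ μ ∈ setAα α} :=
  ⟨by simp, by rw [mem_setAα_iff hμ, neg_zero, weighted_zero]; exact hμ⟩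

lemma bddAbove_indices (μ : Measure ℝ) : BddAbove {α : ℝ | α ∈ Set.Icc (0 : ℝ) 1 ∧ μ ∈ setAα α} :=
  ⟨1, fun _ h => h.1.2⟩

/-- Indeterminacy is inherited by larger measures, so every exponent below the supremum `a(μ)` is
admissible. -/
lemma weighted_mem_Mi_of_lt (hμ : μ ∈ Mi) {β : ℝ} (h : -aIndex μ < β) : weighted β μ ∈ Mi := by
  obtain ⟨α, hα, hlt⟩ := exists_lt_of_lt_csSup ⟨0, zero_mem_indices hμ⟩
    (show -β < aIndex μ by linarith)
  exact weighted_mem_Mi_mono hμ.1 (by linarith) ((mem_setAα_iff hμ α).1 hα.2)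

/-- The supremum `a(μ)` is restricted to exponents in `[0, 1]`; this is no loss, since
`(1 + x²)⁻¹ dμ` is determinate for N-extremal `μ`. -/
lemma weighted_mem_Md_of_lt (hμ : μ ∈ Mi0) {β : ℝ} (h : β < -aIndex μ) : weighted β μ ∈ Md := by
  have hM := hμ.1.1
  by_contra hd
  have hi := (mem_Mi_iff_notMem_Md (weighted_mem_MStar hM β)).2 hd
  have h0 : 0 ≤ aIndex μ := le_csSup (bddAbove_indices μ) (zero_mem_indices hμ.1)
  by_cases h1 : β ≤ -1
  · exact weighted_neg_one_notMem_Mi hM (resolventApprox_of_mem_Mi0 hμ)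
      (weighted_mem_Mi_mono hM h1 hi)
  · have : -β ≤ aIndex μ := le_csSup (bddAbove_indices μ)
      ⟨⟨by linarith, by linarith⟩, by rwa [mem_setAα_iff hμ.1, neg_neg]⟩
    linarith

lemma weighted_neg_mem_Mi0 (hμ : μ ∈ Mi0) {α : ℝ} (hα : 0 ≤ α) (h : weighted (-α) μ ∈ Mi) :
    weighted (-α) μ ∈ Mi0 := by
  refine mem_Mi0_of_resolventApprox h ((resolventApprox_of_mem_Mi0 hμ).mono_measure hμ.1.1.2 ?_)
  conv_rhs => rw [← weighted_zero μ]
  exact weighted_mono (by linarith) μ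

end Weighted

end MomentProblem

end

theorem mainTheorem9 :
    (MomentProblem.setA.Nonempty ↔
      ∃ ν ∈ MomentProblem.Mi0, ∀ δ : ℝ, 0 < δ →
        MomentProblem.weighted (-δ) ν ∈ MomentProblem.Md) ∧
    (MomentProblem.setB.Nonempty ↔
      ∃ ν ∈ MomentProblem.Md, ∀ δ : ℝ, 0 < δ →
        MomentProblem.weighted δ ν ∈ MomentProblem.Mi) := by
  open MomentProblem in
  refine ⟨⟨?_, ?_⟩, ⟨?_, ?_⟩⟩
  · rintro ⟨μ, hμ, hi⟩
    have h0 : 0 ≤ aIndex μ := le_csSup (bddAbove_indices μ) (zero_mem_indices hμ.1)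
    refine ⟨weighted (-aIndex μ) μ, weighted_neg_mem_Mi0 hμ h0 hi, fun δ hδ => ?_⟩
    rw [weighted_weighted]
    exact weighted_mem_Md_of_lt hμ (by linarith)
  · rintro ⟨ν, hν, h⟩
    -- no positive exponent is admissible, so that the index of `ν` vanishes
    have ha : aIndex ν = 0 := by
      refine le_antisymm (csSup_le ⟨0, zero_mem_indices hν.1⟩ fun α hα => ?_)
        (le_csSup (bddAbove_indices ν) (zero_mem_indices hν.1))
      by_contra! hpos
      have hi := (mem_setAα_iff hν.1 α).1 hα.2
      exact (mem_Mi_iff_notMem_Md hi.1).1 hi (h α hpos)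
    refine ⟨ν, hν, ?_⟩
    rw [ha, neg_zero, weighted_zero]
    exact hν.1
  · rintro ⟨μ, hμ, hd⟩
    refine ⟨weighted (-aIndex μ) μ, hd, fun δ hδ => ?_⟩
    rw [weighted_weighted]
    exact weighted_mem_Mi_of_lt hμ.1 (by linarith)
  · rintro ⟨ν, hν, h⟩
    have hi : weighted 1 ν ∈ Mi := h 1 one_pos
    have h0 : weighted 1 ν ∈ Mi0 := mem_Mi0_of_resolventApprox hi
      ((resolventApprox_weighted_one_iff hν.1).2 ((mem_Md_iff hν.1).1 hν))
    have ha : aIndex (weighted 1 ν) = 1 := by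
      refine le_antisymm (csSup_le ⟨0, zero_mem_indices hi⟩ fun α hα => hα.1.2) ?_
      refine le_of_forall_lt fun c hc => ?_
      obtain ⟨α, hα, hα1⟩ := exists_between (max_lt hc one_pos)
      refine lt_of_lt_of_le ((le_max_left _ _).trans_lt hα) (le_csSup (bddAbove_indices _)
        ⟨⟨((le_max_right _ _).trans_lt hα).le, hα1.le⟩, ?_⟩)
      rw [mem_setAα_iff hi, weighted_weighted]
      exact h _ (by linarith)
    refine ⟨weighted 1 ν, h0, ?_⟩
    rw [ha, weighted_weighted, neg_add_cancel, weighted_zero]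
    exact hν
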